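/- Let $X=(X,d,\mu)$ be a complete, unbounded metric space with a Borel measure $\mu$ such that $0<\mu(B)<\infty$ for every closed ball $B=B(x,r)=\{y: d(x,y)\le r\}$, $r>0$, and such that $\mu$ is doubling, i.e. $\mu(B(x,2r))\le C\mu(B(x,r))$ for all $x\in X$, $r>0$, with $C$ independent of $x,r$. For $A\subset X$ and $f\colon A\to\mathbb R$, a Borel function $g\ge 0$ (with values in $[0,\infty]$) is an upper gradient of $f$ in $A$ if $|f(y)-f(x)|\le\int_\gamma g\,ds$ for every compact rectifiable curve $\gamma$ in $A$ with endpoints $x,y$. For $q\ge1$, $X$ supports a $q$-Poincaré inequality if there are $C>0$, $\lambda\ge1$ such that, for every Borel function $f\colon X\to\mathbb R$ that is integrable on balls, every upper gradient $g$ of $f$ in $X$ and every ball $B=B(x,r)$, \[ \frac1{\mu(B)}\int_B|f-f_B|\,d\mu\le C\,r\Bigl(\frac1{\mu(\lambda B)}\int_{\lambda B}g^q\,d\mu\Bigr)^{1/q},\qquad f_B=\frac1{\mu(B)}\int_Bf\,d\mu,\quad \lambda B=B(x,\lambda r). \] For $E\subset X$ put $E_r=\{x: \operatorname{dist}(x,E)<r\}$,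 and let the lower Assouad codimension $\underline{\operatorname{co\,dim}}_A(E)\in[0,\infty]$ be the supremum of all $t\ge0$ for which there is a constant $C\ge1$ with \[ \frac{\mu(E_r\cap B(x,R))}{\mu(B(x,R))}\le C\Bigl(\frac rR\Bigr)^t\qquad\text{for all }x\in E\text{ and all }0<r<R<\infty. \] Let $1\le p<\infty$ and $\beta<p-1$. If $\beta\le0$, assume that $X$ supports a $p$-Poincaré inequality; if $\beta>0$, assume that $X$ supports a $(p-\beta)$-Poincaré inequality. Let $\Omega\subset X$ be an open set with $\underline{\operatorname{co\,dim}}_A(\Omega^c)>p-\beta$, where $\Omega^c=X\setminus\Omega$, and write $d_\Omega(x)=\operatorname{dist}(x,\Omega^c)$ (with $\operatorname{dist}(x,\emptyset)=\infty$). Then the $(p,\beta)$-Hardy inequality holds for all $u\in\operatorname{Lip}_b(\Omega)$: there is a constant $C>0$ such that \[ \int_\Omega|u|^p\,d_\Omega^{\beta-p}\,d\mu\le C\int_\Omega g_u^p\,d_\Omega^{\beta}\,d\mu \] for every Lipschitz function $u\colon\Omega\to\mathbb R$ with bounded support and every upper gradient $g_u$ of $u$ in $\Omega$. In particular, the test functions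 need not vanish on $\Omega^c$. -/

import Mathlib

open MeasureTheory Metric Set
open scoped NNReal ENNReal

/-- `μ` is doubling: `μ(B(x,2r)) ≤ C μ(B(x,r))` for all closed balls of `X`. -/
def IsDoublingMeasure {X : Type*} [MetricSpace X] [MeasurableSpace X] (μ : Measure X) : Prop :=
  ∃ C : ℝ≥0, ∀ (x : X) (r : ℝ), 0 < r →
    μ (closedBall x (2 * r)) ≤ (C : ℝ≥0∞) * μ (closedBall x r)

/-- The Borel function `g ≥ 0` is an upper gradient of `f` in the set `A`: the inequality
`|f(y) - f(x)| ≤ ∫_γ g ds` holds along every compact rectifiable curve `γ` contained in `A`,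
where `x` and `y` are the endpoints of `γ`. Curves are parametrized by arc length on `[0, l]`, so
that `∫_γ g ds` is the integral of `g ∘ γ` over `[0, l]`. Only the values of `f` and `g` in `A`
matter. -/
def IsUpperGradientOn {X : Type*} [MetricSpace X] [MeasurableSpace X]
    (g : X → ℝ≥0∞) (f : X → ℝ) (A : Set X) : Prop :=
  Measurable g ∧
    ∀ (l : ℝ) (γ : ℝ → X), 0 ≤ l → HasUnitSpeedOn γ (Icc 0 l) → MapsTo γ (Icc 0 l) A →
      edist (f (γ 0)) (f (γ l)) ≤ ∫⁻ t in Icc 0 l, g (γ t)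

/-- `X` supports a `(1,q)`-Poincaré inequality. The functions `f` are those for which all the
mean values `f_B` make sense. -/
def SupportsPoincare {X : Type*} [MetricSpace X] [MeasurableSpace X]
    (μ : Measure X) (q : ℝ) : Prop :=
  ∃ (C : ℝ≥0) (lam : ℝ), 1 ≤ lam ∧
    ∀ (f : X → ℝ) (g : X → ℝ≥0∞), Measurable f →
      (∀ (x : X) (r : ℝ), IntegrableOn f (closedBall x r) μ) →
      IsUpperGradientOn g f univ →
      ∀ (x : X) (r : ℝ), 0 < r →
        (⨍⁻ y in closedBall x r, ‖f y - ⨍ z in closedBall x r, f z ∂μ‖ₑ ∂μ) ≤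
          (C : ℝ≥0∞) * ENNReal.ofReal r *
            (⨍⁻ y in closedBall x (lam * r), g y ^ q ∂μ) ^ (1 / q)

/-- The lower Assouad codimension of a subset `E` of an unbounded space: the supremum of all
`t ≥ 0` such that `μ(E_r ∩ B(x,R)) / μ(B(x,R)) ≤ C (r/R)^t` for all `x ∈ E` and `0 < r < R`,
where `E_r` is the open `r`-neighbourhood of `E`. All scales `0 < r < R < ∞` are used. If `E` is
unbounded, this is the range `0 < r < R < diam E`; if `E` is bounded (for instance one point),
the scales above `diam E` are taken into account as well. -/
noncomputable def lowerAssouadCodim {X : Type*} [MetricSpace X] [MeasurableSpace X]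
    (μ : Measure X) (E : Set X) : ℝ≥0∞ :=
  ⨆ (t : ℝ≥0) (_ : ∃ C : ℝ≥0, ∀ x ∈ E, ∀ r R : ℝ, 0 < r → r < R →
      μ (thickening r E ∩ closedBall x R) / μ (closedBall x R) ≤
        (C : ℝ≥0∞) * ENNReal.ofReal ((r / R) ^ (t : ℝ))), (t : ℝ≥0∞)

/-- `Lip_b(Ω)`: the functions that are Lipschitz on `Ω` and have bounded support in `Ω`. Functions
on `Ω` are represented by functions on `X` whose values outside `Ω` are irrelevant. -/
def LipB {X : Type*} [MetricSpace X] (Ω : Set X) : Set (X → ℝ) :=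
  {u | (∃ L : ℝ≥0, LipschitzOnWith L u Ω) ∧ Bornology.IsBounded {x ∈ Ω | u x ≠ 0}}

/-- A `(p,β)`-Hardy inequality holds in `Ω` for all test functions `u ∈ F`, with one constant for
all `u ∈ F` and all upper gradients `g` of `u` in `Ω`. The distance to the complement is
`d_Ω(x) = infEDist x Ωᶜ`, a positive finite number at each point of an open set `Ω ≠ X`. -/
def HardyInequalityFor {X : Type*} [MetricSpace X] [MeasurableSpace X]
    (μ : Measure X) (Ω : Set X) (p β : ℝ) (F : Set (X → ℝ)) : Prop :=
  ∃ C : ℝ≥0, 0 < C ∧ ∀ u ∈ F, ∀ g : X → ℝ≥0∞, IsUpperGradientOn g u Ω →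
    ∫⁻ x in Ω, ‖u x‖ₑ ^ p * infEDist x Ωᶜ ^ (β - p) ∂μ ≤
      (C : ℝ≥0∞) * ∫⁻ x in Ω, g x ^ p * infEDist x Ωᶜ ^ β ∂μ

/-!
Write `E = Ωᶜ`. The average of `|v|` over `B(x, 2 ^ k)` tends to `0` as `k → ∞`, since the total
measure is infinite; telescoping it over all dyadic scales, the Poincaré inequality bounds `|v(x)|`
by a sum of averages of an upper gradient of `v`, over scales comparable to `dist(x, E)` and larger.
Since the codimension of `E` exceeds `p - β`, the averages of `dist(·, E) ^ (-s)` over balls near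
`E` are at most `K * R ^ (-s)` for some `s > p - β`. For `β < 0` this and Fubini's theorem give the
Hardy inequality, with a constant of order `1 / |β|` as `β → 0`. Applied to `v * dist(·, E) ^ θ`
for a small `θ`, this inequality has an error term that can be absorbed into the left-hand side, and
yields the case `β = 0`. Applied to `|v| ^ (p / (p - β))`, the case `β = 0` with exponent `p - β`
and Hölder's inequality yield the case `β > 0`.

Test functions that do not vanish on `E` are multiplied by cutoff functions of `dist(·, E)`. The
integral of `|u| ^ p * dist(·, E) ^ (β - p)` is finite, again by the codimension, so its part over
a thin neighbourhood of `E` is small and controls the error.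
-/

section IntervalCalculus

open Filter Topology

variable {w f η : ℝ → ℝ} {K G G₁ G₂ : ℝ → ℝ≥0∞} {a b : ℝ}

/-- `K` is a one-dimensional upper gradient of `w` on `[a, b]`: its integrals dominate the
increments of `w` over all subintervals. Upper gradients on a metric space induce it along curves
parametrized by arc length. -/
def HasUpperGradientOnIcc (K : ℝ → ℝ≥0∞) (w : ℝ → ℝ) (a b : ℝ) : Prop :=
  ∀ ⦃s t : ℝ⦄, a ≤ s → s ≤ t → t ≤ b → edist (w s) (w t) ≤ ∫⁻ x in Icc s t, K x

theorem lintegral_Icc_add_lintegral_Icc {s t : ℝ} (has : a ≤ s) (hst : s ≤ t) :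
    (∫⁻ x in Icc a s, K x) + ∫⁻ x in Icc s t, K x = ∫⁻ x in Icc a t, K x := by
  have hdisj : Disjoint (Icc a s) (Ioc s t) :=
    disjoint_left.2 fun _ hx hx' => absurd hx.2 (not_le.2 hx'.1)
  rw [← restrict_Ioc_eq_restrict_Icc (a := s) (b := t), ← lintegral_union measurableSet_Ioc hdisj,
    Icc_union_Ioc_eq_Icc has hst]

theorem lintegral_Icc_comp_add_left (K : ℝ → ℝ≥0∞) (a b : ℝ) :
    ∫⁻ t in Icc 0 (b - a), K (a + t) = ∫⁻ t in Icc a b, K t := by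
  have h := (measurePreserving_add_left volume a).setLIntegral_comp_preimage_emb
    (measurableEmbedding_addLeft a) K (Icc a b)
  rwa [preimage_const_add_Icc, sub_self] at h

theorem lintegral_ne_top_of_mul {c : ℝ → ℝ} (hc : ContinuousOn c (Icc a b))
    (hc₀ : ∀ x ∈ Icc a b, c x ≠ 0) (h : ∫⁻ x in Icc a b, ‖c x‖ₑ * G x ≠ ∞) :
    ∫⁻ x in Icc a b, G x ≠ ∞ := by
  rcases (Icc a b).eq_empty_or_nonempty with he | hne
  · simp [he]
  obtain ⟨x₀, hx₀, hmin⟩ := isCompact_Icc.exists_isMinOn hne hc.enorm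
  have hmul : ‖c x₀‖ₑ * ∫⁻ x in Icc a b, G x ≤ ∫⁻ x in Icc a b, ‖c x‖ₑ * G x := by
    rw [← lintegral_const_mul' _ _ enorm_ne_top]
    exact setLIntegral_mono' measurableSet_Icc fun x hx => mul_le_mul_left (hmin hx) _
  intro htop
  rw [htop, ENNReal.mul_top (by simpa using hc₀ x₀ hx₀)] at hmul
  exact h (top_le_iff.1 hmul)

theorem exists_pos_forall_mul_lintegral_le {α : ℝ → ℝ≥0} (hα : ContinuousOn α (Icc a b))
    (G : ℝ → ℝ≥0∞) {ε : ℝ≥0} (hε : 0 < ε) :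
    ∃ δ > 0, ∀ ⦃s t σ : ℝ⦄, a ≤ s → t ≤ b → t - s ≤ δ → σ ∈ Icc s t →
      α σ * ∫⁻ x in Icc s t, G x ≤ ∫⁻ x in Icc s t, (α x * G x + ε * G x) := by
  have hunif := isCompact_Icc.uniformContinuousOn_of_continuous hα
  obtain ⟨δ, hδ, hclose⟩ := Metric.uniformContinuousOn_iff_le.1 hunif ε (by exact_mod_cast hε)
  refine ⟨δ, hδ, fun s t σ has htb hts hσ => ?_⟩
  have hsub : Icc s t ⊆ Icc a b := Icc_subset_Icc has htb
  rw [← lintegral_const_mul' _ _ ENNReal.coe_ne_top]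
  refine setLIntegral_mono' measurableSet_Icc fun x hx => ?_
  have hαx : α σ ≤ α x + ε := by
    have := (abs_le.1 (hclose σ (hsub hσ) x (hsub hx)
      ((Real.dist_le_of_mem_Icc hσ hx).trans hts))).2
    exact_mod_cast (sub_le_iff_le_add'.1 this : (α σ : ℝ) ≤ α x + ε)
  rw [← add_mul]
  gcongr
  exact_mod_cast hαx

theorem exists_mem_uIcc_sub_eq_mul_sub {φ φ' : ℝ → ℝ} {x y : ℝ}
    (hφ : ∀ z ∈ uIcc x y, HasDerivAt φ (φ' z) z) :
    ∃ ξ ∈ uIcc x y, φ y - φ x = φ' ξ * (y - x) := by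
  wlog hxy : x ≤ y generalizing x y
  · obtain ⟨ξ, hξ, h⟩ := this (by rwa [uIcc_comm]) (le_of_not_ge hxy)
    exact ⟨ξ, by rwa [uIcc_comm], by linarith⟩
  rcases hxy.eq_or_lt with rfl | hlt
  · exact ⟨x, left_mem_uIcc, by simp⟩
  rw [uIcc_of_le hxy] at hφ ⊢
  obtain ⟨ξ, hξ, h⟩ := exists_hasDerivAt_eq_slope φ φ' hlt
    (fun z hz => (hφ z hz).continuousAt.continuousWithinAt)
    fun z hz => hφ z (Ioo_subset_Icc_self hz)
  exact ⟨ξ, Ioo_subset_Icc_self hξ, by rw [h, div_mul_cancel₀ _ (sub_pos.2 hlt).ne']⟩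

theorem edist_le_lintegral_of_forall_Ico (hab : a ≤ b) (hw : ContinuousWithinAt w (Icc a b) b)
    (h : ∀ x ∈ Ico a b, edist (w a) (w x) ≤ ∫⁻ u in Icc a x, K u) :
    edist (w a) (w b) ≤ ∫⁻ u in Icc a b, K u := by
  rcases hab.eq_or_lt with rfl | hlt
  · simp
  have : (𝓝[Ico a b] b).NeBot := right_nhdsWithin_Ico_neBot hlt
  refine le_of_tendsto (tendsto_const_nhds.edist (hw.mono Ico_subset_Icc_self)) ?_
  filter_upwards [self_mem_nhdsWithin] with x hx
  exact (h x hx).trans (lintegral_mono_set (Icc_subset_Icc le_rfl hx.2.le))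

theorem edist_le_lintegral_of_forall_Ioc (hab : a ≤ b) (hw : ContinuousWithinAt w (Icc a b) a)
    (h : ∀ x ∈ Ioc a b, edist (w x) (w b) ≤ ∫⁻ u in Icc x b, K u) :
    edist (w a) (w b) ≤ ∫⁻ u in Icc a b, K u := by
  rcases hab.eq_or_lt with rfl | hlt
  · simp
  have : (𝓝[Ioc a b] a).NeBot := left_nhdsWithin_Ioc_neBot hlt
  refine le_of_tendsto (Tendsto.edist (hw.mono Ioc_subset_Icc_self) tendsto_const_nhds) ?_
  filter_upwards [self_mem_nhdsWithin] with x hx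
  exact (h x hx).trans (lintegral_mono_set (Icc_subset_Icc hx.1.le le_rfl))

namespace HasUpperGradientOnIcc

theorem mono (h : HasUpperGradientOnIcc K w a b) {s t : ℝ} (has : a ≤ s) (htb : t ≤ b) :
    HasUpperGradientOnIcc K w s t :=
  fun _ _ hs hst ht => h (has.trans hs) hst (ht.trans htb)

theorem of_lintegral_ne_top
    (h : ∀ s t, a ≤ s → t ≤ b → ∫⁻ x in Icc s t, K x ≠ ∞ → HasUpperGradientOnIcc K w s t) :
    HasUpperGradientOnIcc K w a b := by
  intro s t hs hst ht
  by_cases hK : ∫⁻ x in Icc s t, K x = ∞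
  · exact hK ▸ le_top
  · exact h s t hs ht hK le_rfl hst le_rfl

theorem of_short {δ : ℝ} (hδ : 0 < δ)
    (h : ∀ s t, a ≤ s → s ≤ t → t ≤ b → t - s ≤ δ → edist (w s) (w t) ≤ ∫⁻ x in Icc s t, K x) :
    HasUpperGradientOnIcc K w a b := by
  intro s t has hst htb
  suffices key : ∀ n : ℕ, ∀ y, s ≤ y → y ≤ b → y - s ≤ n * δ →
      edist (w s) (w y) ≤ ∫⁻ x in Icc s y, K x by
    obtain ⟨n, hn⟩ := exists_nat_ge ((t - s) / δ)
    exact key n t hst htb (by rwa [div_le_iff₀ hδ] at hn)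
  intro n
  induction n with
  | zero =>
    intro y hsy _ hn
    obtain rfl : y = s := by
      rw [Nat.cast_zero, zero_mul] at hn
      linarith
    simp
  | succ n ih =>
    intro y hsy hyb hn
    have hz₁ : s ≤ max s (y - δ) := le_max_left _ _
    have hz₂ : max s (y - δ) ≤ y := max_le hsy (by linarith)
    have hn' : max s (y - δ) - s ≤ n * δ := by
      push_cast at hn
      exact sub_le_iff_le_add.2 (max_le (by linarith [show 0 ≤ (n : ℝ) * δ by positivity])
        (by linarith))
    calc edist (w s) (w y) ≤ edist (w s) (w (max s (y - δ))) + edist (w (max s (y - δ))) (w y) :=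
          edist_triangle _ _ _
      _ ≤ (∫⁻ x in Icc s (max s (y - δ)), K x) + ∫⁻ x in Icc (max s (y - δ)) y, K x :=
          add_le_add (ih _ hz₁ (hz₂.trans hyb) hn')
            (h _ _ (has.trans hz₁) hz₂ hyb (by linarith [le_max_right s (y - δ)]))
      _ = ∫⁻ x in Icc s y, K x := lintegral_Icc_add_lintegral_Icc hz₁ hz₂

theorem of_forall_pos (hGm : AEMeasurable G (volume.restrict (Icc a b)))
    (hG : ∫⁻ x in Icc a b, G x ≠ ∞)
    (h : ∀ ε : ℝ≥0, 0 < ε → HasUpperGradientOnIcc (fun x => K x + ε * G x) w a b) :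
    HasUpperGradientOnIcc K w a b := by
  intro s t hs hst ht
  have hsub : Icc s t ⊆ Icc a b := Icc_subset_Icc hs ht
  have hGst : ∫⁻ x in Icc s t, G x ≠ ∞ := ne_top_of_le_ne_top hG (lintegral_mono_set hsub)
  have hlim : Tendsto (fun ε : ℝ≥0 => (∫⁻ x in Icc s t, K x) + ε * ∫⁻ x in Icc s t, G x) (𝓝[>] 0)
      (𝓝 ((∫⁻ x in Icc s t, K x) + (0 : ℝ≥0) * ∫⁻ x in Icc s t, G x)) :=
    tendsto_const_nhds.add (ENNReal.Tendsto.mul_const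
      (ENNReal.tendsto_coe.2 (tendsto_id.mono_left nhdsWithin_le_nhds)) (Or.inr hGst))
  rw [ENNReal.coe_zero, zero_mul, add_zero] at hlim
  refine ge_of_tendsto hlim ?_
  filter_upwards [self_mem_nhdsWithin] with ε hε
  rw [← lintegral_const_mul' _ _ ENNReal.coe_ne_top,
    ← lintegral_add_right' _ ((hGm.mono_set hsub).const_mul _)]
  exact h ε hε hs hst ht

theorem of_forall_ne_zero (hw : ContinuousOn w (Icc a b))
    (h : ∀ s t, a ≤ s → s ≤ t → t ≤ b → (∀ x ∈ Icc s t, w x ≠ 0) →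
      edist (w s) (w t) ≤ ∫⁻ x in Icc s t, K x) :
    HasUpperGradientOnIcc K w a b := by
  intro s t hs hst ht
  have hw' : ContinuousOn w (Icc s t) := hw.mono (Icc_subset_Icc hs ht)
  rcases (Icc s t ∩ w ⁻¹' {0}).eq_empty_or_nonempty with hempty | hne
  · exact h s t hs hst ht fun x hx hx₀ => hempty.subset ⟨hx, hx₀⟩
  have hcompact : IsCompact (Icc s t ∩ w ⁻¹' {0}) :=
    isCompact_Icc.of_isClosed_subset (hw'.preimage_isClosed_of_isClosed isClosed_Icc
      isClosed_singleton) inter_subset_left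
  obtain ⟨y, ⟨⟨hsy, hyt⟩, hwy⟩, hleast⟩ := hcompact.exists_isLeast hne
  obtain ⟨z, ⟨⟨hsz, hzt⟩, hwz⟩, hgreatest⟩ := hcompact.exists_isGreatest hne
  have hyz : y ≤ z := hgreatest ⟨⟨hsy, hyt⟩, hwy⟩
  have hleft : edist (w s) (w y) ≤ ∫⁻ x in Icc s y, K x :=
    edist_le_lintegral_of_forall_Ico hsy
      ((hw' y ⟨hsy, hyt⟩).mono (Icc_subset_Icc le_rfl hyt)) fun x hx =>
      h s x hs hx.1 (hx.2.le.trans (hyt.trans ht)) fun u hu hu₀ =>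
        (hu.2.trans_lt hx.2).not_ge (hleast ⟨⟨hu.1, hu.2.trans (hx.2.le.trans hyt)⟩, hu₀⟩)
  have hright : edist (w z) (w t) ≤ ∫⁻ x in Icc z t, K x :=
    edist_le_lintegral_of_forall_Ioc hzt
      ((hw' z ⟨hsz, hzt⟩).mono (Icc_subset_Icc hsz le_rfl)) fun x hx =>
      h x t (hs.trans (hsz.trans hx.1.le)) hx.2 ht fun u hu hu₀ =>
        (hx.1.trans_le hu.1).not_ge (hgreatest ⟨⟨hsz.trans (hx.1.le.trans hu.1), hu.2⟩, hu₀⟩)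
  calc edist (w s) (w t) ≤ edist (w s) (w y) + edist (w z) (w t) := by
        rw [show w y = 0 from hwy, show w z = 0 from hwz]
        exact edist_triangle _ _ _
    _ ≤ (∫⁻ x in Icc s y, K x) + ∫⁻ x in Icc z t, K x := add_le_add hleft hright
    _ ≤ (∫⁻ x in Icc s y, K x) + ∫⁻ x in Icc y t, K x := by gcongr
    _ = ∫⁻ x in Icc s t, K x := lintegral_Icc_add_lintegral_Icc hsy hyt

theorem mul (hf : ContinuousOn f (Icc a b)) (hη : ContinuousOn η (Icc a b))
    (hη₀ : ∀ x ∈ Icc a b, η x ≠ 0)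
    (hm₁ : AEMeasurable G₁ (volume.restrict (Icc a b)))
    (hm₂ : AEMeasurable G₂ (volume.restrict (Icc a b))) (hG₂ : ∫⁻ x in Icc a b, G₂ x ≠ ∞)
    (h₁ : HasUpperGradientOnIcc G₁ f a b) (h₂ : HasUpperGradientOnIcc G₂ η a b) :
    HasUpperGradientOnIcc (fun x => ‖η x‖ₑ * G₁ x + ‖f x‖ₑ * G₂ x) (fun x => f x * η x) a b := by
  refine of_lintegral_ne_top fun c d hc hd hfin => ?_
  have hsub : Icc c d ⊆ Icc a b := Icc_subset_Icc hc hd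
  have hG₁ : ∫⁻ x in Icc c d, G₁ x ≠ ∞ := lintegral_ne_top_of_mul (hη.mono hsub)
    (fun x hx => hη₀ x (hsub hx))
    (ne_top_of_le_ne_top hfin (lintegral_mono fun x => le_self_add))
  have hG : ∫⁻ x in Icc c d, (G₁ x + G₂ x) ≠ ∞ := by
    rw [lintegral_add_left' (hm₁.mono_set hsub)]
    exact ENNReal.add_ne_top.2 ⟨hG₁, ne_top_of_le_ne_top hG₂ (lintegral_mono_set hsub)⟩
  refine of_forall_pos ((hm₁.add hm₂).mono_set hsub) hG fun ε hε => ?_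
  obtain ⟨δ₁, hδ₁, hη'⟩ := exists_pos_forall_mul_lintegral_le (hη.nnnorm.mono hsub) G₁ hε
  obtain ⟨δ₂, hδ₂, hf'⟩ := exists_pos_forall_mul_lintegral_le (hf.nnnorm.mono hsub) G₂ hε
  refine of_short (lt_min hδ₁ hδ₂) fun s t hs hst ht hts => ?_
  calc edist (f s * η s) (f t * η t) = ‖η s * (f s - f t) + f t * (η s - η t)‖ₑ := by
        rw [edist_eq_enorm_sub]; congr 1; ring
    _ ≤ ‖η s‖ₑ * edist (f s) (f t) + ‖f t‖ₑ * edist (η s) (η t) := by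
        simp only [edist_eq_enorm_sub, ← enorm_mul]
        exact enorm_add_le _ _
    _ ≤ ‖η s‖ₑ * (∫⁻ x in Icc s t, G₁ x) + ‖f t‖ₑ * ∫⁻ x in Icc s t, G₂ x := by
        gcongr
        · exact h₁.mono hc hd hs hst ht
        · exact h₂.mono hc hd hs hst ht
    _ ≤ (∫⁻ x in Icc s t, (‖η x‖ₑ * G₁ x + ε * G₁ x)) +
          ∫⁻ x in Icc s t, (‖f x‖ₑ * G₂ x + ε * G₂ x) :=
        add_le_add (hη' hs ht (hts.trans (min_le_left _ _)) (left_mem_Icc.2 hst))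
          (hf' hs ht (hts.trans (min_le_right _ _)) (right_mem_Icc.2 hst))
    _ ≤ ∫⁻ x in Icc s t, ((‖η x‖ₑ * G₁ x + ε * G₁ x) + (‖f x‖ₑ * G₂ x + ε * G₂ x)) :=
        le_lintegral_add _ _
    _ = ∫⁻ x in Icc s t, (‖η x‖ₑ * G₁ x + ‖f x‖ₑ * G₂ x + ε * (G₁ x + G₂ x)) :=
        lintegral_congr fun x => by ring

theorem comp {φ φ' : ℝ → ℝ} (hf : ContinuousOn f (Icc a b))
    (hφ : ∀ x ∈ Icc a b, HasDerivAt φ (φ' (f x)) (f x))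
    (hφ' : ContinuousOn (fun x => φ' (f x)) (Icc a b)) (hφ₀ : ∀ x ∈ Icc a b, φ' (f x) ≠ 0)
    (hm : AEMeasurable G (volume.restrict (Icc a b))) (h : HasUpperGradientOnIcc G f a b) :
    HasUpperGradientOnIcc (fun x => ‖φ' (f x)‖ₑ * G x) (fun x => φ (f x)) a b := by
  refine of_lintegral_ne_top fun c d hc hd hfin => ?_
  have hsub : Icc c d ⊆ Icc a b := Icc_subset_Icc hc hd
  have hG : ∫⁻ x in Icc c d, G x ≠ ∞ :=
    lintegral_ne_top_of_mul (hφ'.mono hsub) (fun x hx => hφ₀ x (hsub hx)) hfin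
  refine of_forall_pos (hm.mono_set hsub) hG fun ε hε => ?_
  obtain ⟨δ, hδ, hφε⟩ := exists_pos_forall_mul_lintegral_le (hφ'.nnnorm.mono hsub) G hε
  refine of_short hδ fun s t hs hst ht hts => ?_
  have hsub' : Icc s t ⊆ Icc a b := Icc_subset_Icc (hc.trans hs) (ht.trans hd)
  have hrange : uIcc (f s) (f t) ⊆ f '' Icc s t := by
    have huIcc : uIcc s t = Icc s t := uIcc_of_le hst
    rw [← huIcc] at hsub' ⊢
    exact intermediate_value_uIcc (hf.mono hsub')
  obtain ⟨ξ, hξ, hmvt⟩ := exists_mem_uIcc_sub_eq_mul_sub (φ := φ) (φ' := φ') fun z hz => by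
    obtain ⟨x, hx, rfl⟩ := hrange hz
    exact hφ x (hsub' hx)
  obtain ⟨σ, hσ, rfl⟩ := hrange hξ
  calc edist (φ (f s)) (φ (f t)) = ‖φ' (f σ)‖ₑ * edist (f s) (f t) := by
        rw [edist_comm, edist_comm (f s), edist_eq_enorm_sub, edist_eq_enorm_sub, hmvt, enorm_mul]
    _ ≤ ‖φ' (f σ)‖ₑ * ∫⁻ x in Icc s t, G x := by
        gcongr
        exact h.mono hc hd hs hst ht
    _ ≤ _ := hφε hs ht hts hσ

end HasUpperGradientOnIcc

end IntervalCalculus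

section UnitSpeedCurves

variable {X : Type*} [MetricSpace X] {γ : ℝ → X}

theorem lipschitzOnWith_of_hasUnitSpeedOn {S : Set ℝ} (hγ : HasUnitSpeedOn γ S) :
    LipschitzOnWith 1 γ S := by
  intro s hs t ht
  wlog hst : s ≤ t generalizing s t
  · simpa only [edist_comm] using this ht hs (le_of_not_ge hst)
  calc edist (γ s) (γ t) ≤ eVariationOn γ (S ∩ Icc s t) :=
        eVariationOn.edist_le γ ⟨hs, le_rfl, hst⟩ ⟨ht, hst, le_rfl⟩
    _ = (1 : ℝ≥0) * edist s t := by
        rw [hγ hs ht, NNReal.coe_one, one_mul, ENNReal.coe_one, one_mul, edist_comm, edist_dist,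
          Real.dist_eq, abs_of_nonneg (sub_nonneg.2 hst)]

theorem hasUnitSpeedOn_comp_add_left {l a b : ℝ} (hγ : HasUnitSpeedOn γ (Icc 0 l)) (ha : 0 ≤ a)
    (hb : b ≤ l) : HasUnitSpeedOn (fun t => γ (a + t)) (Icc 0 (b - a)) := by
  have himage : (fun t => a + t) '' Icc 0 (b - a) = Icc a b := by simp
  intro s hs t ht
  have hs' : a + s ∈ Icc a b := himage ▸ mem_image_of_mem _ hs
  have ht' : a + t ∈ Icc a b := himage ▸ mem_image_of_mem _ ht
  have hsub : Icc a b ⊆ Icc 0 l := Icc_subset_Icc ha hb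
  have hvar := eVariationOn.comp_inter_Icc_eq_of_monotoneOn γ (fun t => a + t)
    ((add_right_mono (a := a)).monotoneOn (Icc 0 (b - a))) hs ht
  have hinter : Icc a b ∩ Icc (a + s) (a + t) = Icc 0 l ∩ Icc (a + s) (a + t) := by
    rw [inter_eq_right.2 (Icc_subset_Icc hs'.1 ht'.2),
      inter_eq_right.2 (Icc_subset_Icc (hsub hs').1 (hsub ht').2)]
  rw [himage, hinter, hγ (hsub hs') (hsub ht'), add_sub_add_left_eq_sub] at hvar
  exact hvar

theorem hasUpperGradientOnIcc_of_lipschitzOnWith {w : ℝ → ℝ} {L : ℝ≥0} {a b : ℝ}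
    (hw : LipschitzOnWith L w (Icc a b)) : HasUpperGradientOnIcc (fun _ => (L : ℝ≥0∞)) w a b := by
  intro s t hs hst ht
  have h := hw ⟨hs, hst.trans ht⟩ ⟨hs.trans hst, ht⟩
  rwa [edist_comm s, edist_dist t, Real.dist_eq, abs_of_nonneg (sub_nonneg.2 hst),
    ← Real.volume_Icc, ← setLIntegral_const] at h

end UnitSpeedCurves

section Cutoff

/-- The piecewise linear cutoff on `ℝ` that vanishes for `s ≤ ε` and equals `1` for `2 * ε ≤ s`;
composed with a distance function it cuts test functions off near a set. -/
noncomputable def cutoff (ε : ℝ≥0) (s : ℝ) : ℝ := min 1 (max 0 (s / ε - 1))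

/-- An upper gradient on `ℝ` of `cutoff ε`. -/
noncomputable def cutoffSlope (ε : ℝ≥0) : ℝ → ℝ≥0∞ :=
  (Iio (2 * ε : ℝ)).indicator fun _ => ((ε⁻¹ : ℝ≥0) : ℝ≥0∞)

variable {ε : ℝ≥0} {s : ℝ}

theorem measurable_cutoffSlope (ε : ℝ≥0) : Measurable (cutoffSlope ε) :=
  measurable_const.indicator measurableSet_Iio

theorem cutoffSlope_le (ε : ℝ≥0) (s : ℝ) : cutoffSlope ε s ≤ (ε⁻¹ : ℝ≥0) :=
  indicator_le_self _ _ _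

theorem lipschitzWith_cutoff (ε : ℝ≥0) : LipschitzWith ε⁻¹ (cutoff ε) := by
  have hlinear : LipschitzWith ε⁻¹ fun s : ℝ => s / ε - 1 := by
    refine LipschitzWith.of_dist_le_mul fun s t => le_of_eq ?_
    rw [dist_sub_right, Real.dist_eq, Real.dist_eq, ← sub_div, abs_div, NNReal.abs_eq,
      NNReal.coe_inv, div_eq_inv_mul]
  exact (hlinear.const_max 0).const_min 1

theorem cutoff_nonneg (ε : ℝ≥0) (s : ℝ) : 0 ≤ cutoff ε s := le_min zero_le_one (le_max_left _ _)

theorem cutoff_le_one (ε : ℝ≥0) (s : ℝ) : cutoff ε s ≤ 1 := min_le_left _ _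

theorem enorm_cutoff_le_one (ε : ℝ≥0) (s : ℝ) : ‖cutoff ε s‖ₑ ≤ 1 := by
  rw [Real.enorm_of_nonneg (cutoff_nonneg ε s)]
  exact ENNReal.ofReal_le_one.2 (cutoff_le_one ε s)

theorem cutoff_eq_zero (hε : 0 < ε) (hs : s ≤ ε) : cutoff ε s = 0 := by
  have : s / ε ≤ 1 := (div_le_one (NNReal.coe_pos.2 hε)).2 hs
  rw [cutoff, max_eq_left (by linarith), min_eq_right zero_le_one]

theorem cutoff_eq_one (hε : 0 < ε) (hs : 2 * ε ≤ s) : cutoff ε s = 1 := by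
  have : 2 ≤ s / ε := (le_div_iff₀ (NNReal.coe_pos.2 hε)).2 hs
  rw [cutoff, max_eq_right (by linarith), min_eq_left (by linarith)]

theorem hasUpperGradientOnIcc_cutoff (hε : 0 < ε) {w : ℝ → ℝ} {a b : ℝ}
    (hw : LipschitzOnWith 1 w (Icc a b)) :
    HasUpperGradientOnIcc (fun x => cutoffSlope ε (w x)) (fun x => cutoff ε (w x)) a b := by
  have hlip : LipschitzOnWith ε⁻¹ (fun x => cutoff ε (w x)) (Icc a b) := by
    simpa [Function.comp_def] using (lipschitzWith_cutoff ε).comp_lipschitzOnWith hw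
  have hone : HasUpperGradientOnIcc (fun x => cutoffSlope ε (w x))
      (fun x => 1 - cutoff ε (w x)) a b := by
    refine .of_forall_ne_zero (continuousOn_const.sub hlip.continuousOn) fun s t hs hst ht hne => ?_
    have hmem : ∀ x ∈ Icc s t, w x < 2 * ε := fun x hx =>
      not_le.1 fun hle => hne x hx (by rw [cutoff_eq_one hε hle, sub_self])
    rw [edist_sub_left]
    refine (hasUpperGradientOnIcc_of_lipschitzOnWith hlip hs hst ht).trans_eq ?_
    exact setLIntegral_congr_fun measurableSet_Icc fun x hx =>
      (indicator_of_mem (s := Iio (2 * ε : ℝ)) (hmem x hx) fun _ => _).symm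
  intro s t hs hst ht
  simpa only [edist_sub_left] using hone hs hst ht

end Cutoff

section UpperGradients

variable {X : Type*} [MetricSpace X] [MeasurableSpace X] {v : X → ℝ} {h : X → ℝ≥0∞}

theorem isUpperGradientOn_univ_of_ne_zero (hv : Continuous v) (hh : Measurable h)
    (H : ∀ (l : ℝ) (γ : ℝ → X), 0 ≤ l → HasUnitSpeedOn γ (Icc 0 l) →
      (∀ t ∈ Icc 0 l, v (γ t) ≠ 0) → edist (v (γ 0)) (v (γ l)) ≤ ∫⁻ t in Icc 0 l, h (γ t)) :
    IsUpperGradientOn h v univ := by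
  refine ⟨hh, fun l γ hl hγ _ => ?_⟩
  have hvγ := hv.comp_continuousOn (lipschitzOnWith_of_hasUnitSpeedOn hγ).continuousOn
  refine HasUpperGradientOnIcc.of_forall_ne_zero (w := fun t => v (γ t)) hvγ
    (fun s t hs hst htl hne => ?_) le_rfl hl le_rfl
  have := H (t - s) (fun x => γ (s + x)) (sub_nonneg.2 hst)
    (hasUnitSpeedOn_comp_add_left hγ hs htl)
    fun x hx => hne _ ⟨by linarith [hx.1], by linarith [hx.2]⟩
  simpa only [add_zero, add_sub_cancel, lintegral_Icc_comp_add_left (fun t => h (γ t))] using this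

namespace IsUpperGradientOn

theorem hasUpperGradientOnIcc {f : X → ℝ} {A : Set X} (hh : IsUpperGradientOn h f A) {l : ℝ}
    {γ : ℝ → X} (hγ : HasUnitSpeedOn γ (Icc 0 l)) (hA : MapsTo γ (Icc 0 l) A) :
    HasUpperGradientOnIcc (fun t => h (γ t)) (fun t => f (γ t)) 0 l := by
  intro s t hs hst ht
  have := hh.2 (t - s) (fun x => γ (s + x)) (sub_nonneg.2 hst)
    (hasUnitSpeedOn_comp_add_left hγ hs ht)
    fun x hx => hA ⟨by linarith [hx.1], by linarith [hx.2]⟩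
  simpa only [add_zero, add_sub_cancel, lintegral_Icc_comp_add_left (fun t => h (γ t))] using this

theorem congr {f f' : X → ℝ} {A : Set X} (hh : IsUpperGradientOn h f A) (hf : EqOn f f' A) :
    IsUpperGradientOn h f' A := by
  refine ⟨hh.1, fun l γ hl hγ hA => ?_⟩
  rw [← hf (hA (left_mem_Icc.2 hl)), ← hf (hA (right_mem_Icc.2 hl))]
  exact hh.2 l γ hl hγ hA

variable [BorelSpace X]

theorem indicator_ne_zero (hh : IsUpperGradientOn h v univ) (hv : Continuous v) :
    IsUpperGradientOn ({x | v x ≠ 0}.indicator h) v univ := by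
  refine isUpperGradientOn_univ_of_ne_zero hv
    (hh.1.indicator (isOpen_ne_fun hv continuous_const).measurableSet) fun l γ hl hγ hne => ?_
  refine (hh.2 l γ hl hγ (mapsTo_univ _ _)).trans_eq ?_
  exact setLIntegral_congr_fun measurableSet_Icc fun t ht =>
    (indicator_of_mem (s := {x | v x ≠ 0}) (hne t ht) h).symm

theorem abs_rpow (hh : IsUpperGradientOn h v univ) (hv : Continuous v) {a : ℝ} (ha : 0 < a) :
    IsUpperGradientOn (fun x => ENNReal.ofReal (a * |v x| ^ (a - 1)) * h x)
      (fun x => |v x| ^ a) univ := by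
  have hmeas : Measurable fun x => a * |v x| ^ (a - 1) :=
    (hv.abs.measurable.pow_const _).const_mul _
  refine isUpperGradientOn_univ_of_ne_zero (hv.abs.rpow_const fun _ => Or.inr ha.le)
    (hmeas.ennreal_ofReal.mul hh.1) fun l γ hl hγ hne => ?_
  have hγc : ContinuousOn γ (Icc 0 l) := (lipschitzOnWith_of_hasUnitSpeedOn hγ).continuousOn
  have hpos : ∀ t ∈ Icc 0 l, 0 < |v (γ t)| := fun t ht =>
    abs_pos.2 fun h₀ => hne t ht (by rw [h₀, abs_zero, Real.zero_rpow ha.ne'])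
  have hcont : ContinuousOn (fun t => |v (γ t)|) (Icc 0 l) := hv.abs.comp_continuousOn hγc
  have habs : HasUpperGradientOnIcc (fun t => h (γ t)) (fun t => |v (γ t)|) 0 l :=
    fun s t hs hst ht => (show edist |v (γ s)| |v (γ t)| ≤ edist (v (γ s)) (v (γ t)) by
      simpa using lipschitzWith_one_norm (v (γ s)) (v (γ t))).trans <|
      hh.hasUpperGradientOnIcc hγ (mapsTo_univ _ _) hs hst ht
  have hchain := habs.comp (φ := fun s => s ^ a) (φ' := fun s => a * s ^ (a - 1)) hcont
    (fun t ht => Real.hasDerivAt_rpow_const (Or.inl (hpos t ht).ne'))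
    (continuousOn_const.mul (hcont.rpow_const fun t ht => Or.inl (hpos t ht).ne'))
    (fun t ht => (mul_pos ha (Real.rpow_pos_of_pos (hpos t ht) _)).ne')
    (hh.1.comp_aemeasurable (hγc.aemeasurable measurableSet_Icc))
  refine (hchain le_rfl hl le_rfl).trans_eq (lintegral_congr fun t => ?_)
  rw [Real.enorm_of_nonneg (by positivity), Function.comp_apply]

theorem mul_rpow (hh : IsUpperGradientOn h v univ) (hv : Continuous v) {d : X → ℝ}
    (hd : LipschitzWith 1 d) (hd₀ : ∀ x, 0 ≤ d x) {θ : ℝ} (hθ : 0 < θ) :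
    IsUpperGradientOn
      (fun x => ENNReal.ofReal (d x ^ θ) * h x + ‖v x‖ₑ * ENNReal.ofReal (θ * d x ^ (θ - 1)))
      (fun x => v x * d x ^ θ) univ := by
  have hdc : Continuous fun x => d x ^ θ := hd.continuous.rpow_const fun _ => Or.inr hθ.le
  have hmeas : Measurable fun x => θ * d x ^ (θ - 1) :=
    (hd.continuous.measurable.pow_const _).const_mul _
  refine isUpperGradientOn_univ_of_ne_zero (hv.mul hdc)
    ((hdc.measurable.ennreal_ofReal.mul hh.1).add (hv.measurable.enorm.mul hmeas.ennreal_ofReal))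
    fun l γ hl hγ hne => ?_
  have hγL := lipschitzOnWith_of_hasUnitSpeedOn hγ
  have hγc : ContinuousOn γ (Icc 0 l) := hγL.continuousOn
  have hpos : ∀ t ∈ Icc 0 l, 0 < d (γ t) := fun t ht => (hd₀ _).lt_of_ne' fun h₀ =>
    hne t ht (by rw [h₀, Real.zero_rpow hθ.ne', mul_zero])
  have hcont : ContinuousOn (fun t => d (γ t)) (Icc 0 l) := hd.continuous.comp_continuousOn hγc
  have hcont' : ContinuousOn (fun t => θ * d (γ t) ^ (θ - 1)) (Icc 0 l) :=
    continuousOn_const.mul (hcont.rpow_const fun t ht => Or.inl (hpos t ht).ne')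
  have hdist : HasUpperGradientOnIcc (fun _ => 1) (fun t => d (γ t)) 0 l := by
    simpa [Function.comp_def] using
      hasUpperGradientOnIcc_of_lipschitzOnWith (hd.comp_lipschitzOnWith hγL)
  have hweight : HasUpperGradientOnIcc (fun t => ‖θ * d (γ t) ^ (θ - 1)‖ₑ)
      (fun t => d (γ t) ^ θ) 0 l := by
    simpa only [mul_one] using
      hdist.comp (φ := fun s => s ^ θ) (φ' := fun s => θ * s ^ (θ - 1)) hcont
      (fun t ht => Real.hasDerivAt_rpow_const (Or.inl (hpos t ht).ne')) hcont'
      (fun t ht => (mul_pos hθ (Real.rpow_pos_of_pos (hpos t ht) _)).ne') aemeasurable_const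
  have hprod := (hh.hasUpperGradientOnIcc hγ (mapsTo_univ _ _)).mul (hv.comp_continuousOn hγc)
    (hdc.comp_continuousOn hγc) (fun t ht => (Real.rpow_pos_of_pos (hpos t ht) _).ne')
    (hh.1.comp_aemeasurable (hγc.aemeasurable measurableSet_Icc))
    (hcont'.aemeasurable measurableSet_Icc).enorm hcont'.integrableOn_Icc.2.ne hweight
  refine (hprod le_rfl hl le_rfl).trans_eq (lintegral_congr fun t => ?_)
  have := hd₀ (γ t)
  simp only [Function.comp_apply]
  rw [Real.enorm_of_nonneg (r := d (γ t) ^ θ) (by positivity),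
    Real.enorm_of_nonneg (r := θ * _) (by positivity)]

theorem mul_cutoff {u d : X → ℝ} {g : X → ℝ≥0∞} {Ω : Set X} (hg : IsUpperGradientOn g u Ω)
    (hu : ContinuousOn u Ω) (hum : Measurable u) (hd : LipschitzWith 1 d)
    (hΩ : ∀ x, 0 < d x → x ∈ Ω) {ε : ℝ≥0} (hε : 0 < ε)
    (hcut : Continuous fun x => u x * cutoff ε (d x)) :
    IsUpperGradientOn
      (fun x => g x + ‖u x‖ₑ * cutoffSlope ε (d x)) (fun x => u x * cutoff ε (d x)) univ := by
  have hρ : Measurable fun x => cutoffSlope ε (d x) :=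
    (measurable_cutoffSlope ε).comp hd.continuous.measurable
  refine isUpperGradientOn_univ_of_ne_zero hcut (hg.1.add (hum.enorm.mul hρ))
    fun l γ hl hγ hne => ?_
  have hγL := lipschitzOnWith_of_hasUnitSpeedOn hγ
  have hγc : ContinuousOn γ (Icc 0 l) := hγL.continuousOn
  have hmem : MapsTo γ (Icc 0 l) Ω := fun t ht => hΩ _ <| (NNReal.coe_pos.2 hε).trans <|
    not_le.1 fun hle => hne t ht (by rw [cutoff_eq_zero hε hle, mul_zero])
  have hρfin : ∫⁻ t in Icc 0 l, cutoffSlope ε (d (γ t)) ≠ ∞ := by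
    refine ne_top_of_le_ne_top (b := ∫⁻ _ in Icc 0 l, ((ε⁻¹ : ℝ≥0) : ℝ≥0∞)) ?_
      (lintegral_mono fun t => cutoffSlope_le ε _)
    simpa only [setLIntegral_const, Real.volume_Icc] using
      ENNReal.mul_ne_top ENNReal.coe_ne_top ENNReal.ofReal_ne_top
  have hprod := (hg.hasUpperGradientOnIcc hγ hmem).mul (hu.comp hγc hmem)
    (((lipschitzWith_cutoff ε).continuous.comp hd.continuous).comp_continuousOn hγc)
    (fun t ht => right_ne_zero_of_mul (hne t ht))
    (hg.1.comp_aemeasurable (hγc.aemeasurable measurableSet_Icc))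
    (hρ.comp_aemeasurable (hγc.aemeasurable measurableSet_Icc)) hρfin
    (hasUpperGradientOnIcc_cutoff hε
      (by simpa [Function.comp_def] using hd.comp_lipschitzOnWith hγL))
  refine (hprod le_rfl hl le_rfl).trans (lintegral_mono fun t => ?_)
  exact add_le_add_left (mul_le_of_le_one_left zero_le (enorm_cutoff_le_one ε _)) _

end IsUpperGradientOn

end UpperGradients

section DoublingMeasures

open Filter Topology

variable {X : Type*} [MetricSpace X] [MeasurableSpace X] {μ : Measure X} {D : ℝ≥0}

/-- All closed balls of positive radius have positive and finite measure. -/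
structure IsPosFiniteOnBalls (μ : Measure X) : Prop where
  pos : ∀ (x : X) {r : ℝ}, 0 < r → 0 < μ (closedBall x r)
  lt_top : ∀ (x : X) {r : ℝ}, 0 < r → μ (closedBall x r) < ∞

/-- `μ` is a doubling measure with doubling constant `D`, nontrivial on balls. -/
structure IsDoublingWith (μ : Measure X) (D : ℝ≥0) : Prop extends IsPosFiniteOnBalls μ where
  two_mul_le : ∀ (x : X) {r : ℝ}, 0 < r → μ (closedBall x (2 * r)) ≤ D * μ (closedBall x r)

theorem tendsto_measure_closedBall (x : X) {R : ℕ → ℝ} (hR : Monotone R)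
    (hR' : Tendsto R atTop atTop) :
    Tendsto (fun n => μ (closedBall x (R n))) atTop (𝓝 (μ univ)) := by
  have hcover : ⋃ n : ℕ, closedBall x (R n) = univ := eq_univ_of_forall fun y =>
    mem_iUnion.2 (hR'.eventually_ge_atTop (dist y x)).exists
  rw [← hcover]
  exact tendsto_measure_iUnion_atTop fun _ _ hmn => closedBall_subset_closedBall (hR hmn)

namespace IsPosFiniteOnBalls

theorem sigmaFinite (hμ : IsPosFiniteOnBalls μ) : SigmaFinite μ := by
  rcases isEmpty_or_nonempty X with hX | ⟨⟨x⟩⟩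
  · rw [Measure.eq_zero_of_isEmpty μ]
    infer_instance
  · refine ⟨⟨⟨fun n => closedBall x n, fun _ => trivial, fun n => ?_, iUnion_closedBall_nat x⟩⟩⟩
    exact (measure_mono (closedBall_subset_closedBall (by simp))).trans_lt
      (hμ.lt_top x (Nat.cast_add_one_pos n))

variable [BorelSpace X]

theorem countable_of_isSeparated (hμ : IsPosFiniteOnBalls μ) {ε : ℝ≥0} (hε : 0 < ε) {N : Set X}
    (hN : IsSeparated ε N) : N.Countable := by
  have := hμ.sigmaFinite
  have hdisj : Pairwise (Function.onFun Disjoint fun x : N => closedBall (x : X) (ε / 2)) := by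
    refine fun x y hxy => closedBall_disjoint_closedBall ?_
    have hlt : (ε : ℝ≥0∞) < edist (x : X) y := hN x.2 y.2 (Subtype.coe_injective.ne hxy)
    rw [edist_nndist, ENNReal.coe_lt_coe, ← NNReal.coe_lt_coe, coe_nndist] at hlt
    linarith
  have hcount := Measure.countable_meas_pos_of_disjoint_iUnion (μ := μ)
    (fun x : N => measurableSet_closedBall) hdisj
  have huniv : {x : N | 0 < μ (closedBall (x : X) (ε / 2))} = univ :=
    eq_univ_of_forall fun x => hμ.pos x (half_pos (NNReal.coe_pos.2 hε))
  rw [huniv] at hcount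
  exact countable_coe_iff.1 (countable_univ_iff.1 hcount)

theorem secondCountableTopology (hμ : IsPosFiniteOnBalls μ) : SecondCountableTopology X := by
  refine secondCountable_of_almost_dense_set fun ε hε => ?_
  lift ε to ℝ≥0 using hε.le
  obtain ⟨N, hN⟩ := zorn_subset {N : Set X | N ⊆ univ ∧ IsSeparated ε N} fun c hc hchain =>
    ⟨⋃₀ c, ⟨subset_univ _, (pairwise_sUnion hchain.directedOn).2 fun s hs => (hc hs).2⟩,
      fun _ => subset_sUnion_of_mem⟩
  refine ⟨N, hμ.countable_of_isSeparated (by exact_mod_cast hε) hN.prop.2, fun x => ?_⟩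
  have hcover := isCover_iff_subset_iUnion_closedBall.1 (IsCover.of_maximal_isSeparated hN)
  simpa using hcover (mem_univ x)

end IsPosFiniteOnBalls

namespace IsDoublingWith

theorem measure_closedBall_two_pow_mul_le (hμ : IsDoublingWith μ D) (n : ℕ) (x : X) {r : ℝ}
    (hr : 0 < r) : μ (closedBall x (2 ^ n * r)) ≤ (D ^ n : ℝ≥0) * μ (closedBall x r) := by
  induction n with
  | zero => simp
  | succ n ih =>
    calc μ (closedBall x (2 ^ (n + 1) * r)) = μ (closedBall x (2 * (2 ^ n * r))) := by
          rw [pow_succ', mul_assoc]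
      _ ≤ D * μ (closedBall x (2 ^ n * r)) := hμ.two_mul_le x (by positivity)
      _ ≤ D * ((D ^ n : ℝ≥0) * μ (closedBall x r)) := by gcongr
      _ = _ := by rw [← mul_assoc, pow_succ', ENNReal.coe_mul]

theorem exists_measure_closedBall_le (hμ : IsDoublingWith μ D) (c : ℝ) :
    ∃ K : ℝ≥0, ∀ (x y : X) (r : ℝ), 0 < r → dist x y ≤ c * r →
      μ (closedBall y (c * r)) ≤ K * μ (closedBall x r) := by
  obtain ⟨n, hn⟩ := pow_unbounded_of_one_lt (2 * c) one_lt_two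
  refine ⟨D ^ n, fun x y r hr hxy => ?_⟩
  refine (measure_mono (closedBall_subset_closedBall' ?_)).trans
    (hμ.measure_closedBall_two_pow_mul_le n x hr)
  rw [dist_comm]
  nlinarith

theorem inv_measure_closedBall_le (hμ : IsDoublingWith μ D) {x y : X} {R : ℝ} (hR : 0 < R)
    (hxy : dist x y ≤ R) : (μ (closedBall x R))⁻¹ ≤ D * (μ (closedBall y R))⁻¹ := by
  have hle : μ (closedBall y R) ≤ D * μ (closedBall x R) :=
    (measure_mono (closedBall_subset_closedBall' (by rw [dist_comm]; linarith))).trans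
      (hμ.two_mul_le x hR)
  rw [← div_eq_mul_inv, ENNReal.le_div_iff_mul_le (Or.inl (hμ.pos y hR).ne')
    (Or.inl (hμ.lt_top y hR).ne)]
  calc (μ (closedBall x R))⁻¹ * μ (closedBall y R)
      ≤ (μ (closedBall x R))⁻¹ * (D * μ (closedBall x R)) := by gcongr
    _ = D := by
        rw [mul_left_comm, ENNReal.inv_mul_cancel (hμ.pos x hR).ne' (hμ.lt_top x hR).ne, mul_one]

variable [BorelSpace X]

theorem exists_measure_closedBall_add_div_le (hμ : IsDoublingWith μ D)
    (hX : ¬ Bornology.IsBounded (univ : Set X)) :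
    ∃ K : ℝ≥0, ∀ (x : X) (R : ℝ), 0 < R →
      μ (closedBall x R) + μ (closedBall x R) / K ≤ μ univ := by
  obtain ⟨K, hK⟩ := hμ.exists_measure_closedBall_le 4
  refine ⟨K, fun x R hR => ?_⟩
  obtain ⟨y, hy⟩ : ∃ y, 3 * R < dist x y := by
    by_contra! hcon
    exact hX ((isBounded_iff_subset_closedBall x).2 ⟨_, fun y _ => mem_closedBall'.2 (hcon y)⟩)
  have hdisj : Disjoint (closedBall x R) (closedBall y (dist x y / 3)) :=
    closedBall_disjoint_closedBall (by linarith)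
  have hle : μ (closedBall x R) ≤ K * μ (closedBall y (dist x y / 3)) :=
    (measure_mono (closedBall_subset_closedBall (by linarith))).trans
      (hK y x _ (by linarith) (by rw [dist_comm]; linarith))
  calc μ (closedBall x R) + μ (closedBall x R) / K
      ≤ μ (closedBall x R) + μ (closedBall y (dist x y / 3)) := by
        gcongr
        exact ENNReal.div_le_of_le_mul' hle
    _ = μ (closedBall x R ∪ closedBall y (dist x y / 3)) :=
        (measure_union hdisj measurableSet_closedBall).symm
    _ ≤ μ univ := measure_mono (subset_univ _)

theorem measure_univ_eq_top (hμ : IsDoublingWith μ D)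
    (hX : ¬ Bornology.IsBounded (univ : Set X)) : μ univ = ∞ := by
  obtain ⟨K, hK⟩ := hμ.exists_measure_closedBall_add_div_le hX
  obtain ⟨x⟩ : Nonempty X := not_isEmpty_iff.1 fun _ => hX (by simp [univ_eq_empty_iff.2 ‹_›])
  have hpos : μ univ ≠ 0 := ((hμ.pos x one_pos).trans_le (measure_mono (subset_univ _))).ne'
  have hlim : Tendsto (fun n : ℕ => μ (closedBall x ((n + 1 : ℕ) : ℝ))) atTop (𝓝 (μ univ)) :=
    tendsto_measure_closedBall x (Nat.mono_cast.comp (add_left_mono (a := 1)))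
      (tendsto_natCast_atTop_atTop.comp (tendsto_add_atTop_nat 1))
  have hle : μ univ + μ univ / K ≤ μ univ :=
    le_of_tendsto' (hlim.add (ENNReal.Tendsto.div_const hlim (Or.inl hpos)))
      fun n => hK x _ (Nat.cast_pos.2 n.succ_pos)
  by_contra htop
  refine hle.not_gt (ENNReal.lt_add_right htop ?_)
  simp [ENNReal.div_eq_zero_iff, hpos]

end IsDoublingWith

section Averages

variable [BorelSpace X] [SecondCountableTopology X] [SFinite μ] {w H : X → ℝ≥0∞}

theorem measurableSet_dist_le (R : ℝ) : MeasurableSet {z : X × X | dist z.2 z.1 ≤ R} :=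
  (isClosed_le (continuous_snd.dist continuous_fst) continuous_const).measurableSet

theorem measurable_setLIntegral_closedBall (hH : Measurable H) (R : ℝ) :
    Measurable fun x => ∫⁻ y in closedBall x R, H y ∂μ := by
  simp_rw [← lintegral_indicator measurableSet_closedBall]
  exact ((hH.comp measurable_snd).indicator (measurableSet_dist_le R)).lintegral_prod_right'

theorem measurable_measure_closedBall (R : ℝ) : Measurable fun x => μ (closedBall x R) := by
  simpa using measurable_setLIntegral_closedBall (μ := μ) (measurable_const (a := 1)) R

theorem measurable_setLAverage_closedBall (hH : Measurable H) (R : ℝ) :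
    Measurable fun x => ⨍⁻ y in closedBall x R, H y ∂μ := by
  simp_rw [setLAverage_eq]
  exact (measurable_setLIntegral_closedBall hH R).div (measurable_measure_closedBall R)

theorem lintegral_mul_setLIntegral_closedBall_comm (hw : Measurable w) (hH : Measurable H)
    (R : ℝ) :
    ∫⁻ x, w x * ∫⁻ y in closedBall x R, H y ∂μ ∂μ =
      ∫⁻ y, H y * ∫⁻ x in closedBall y R, w x ∂μ ∂μ := by
  set S : Set (X × X) := {z | dist z.2 z.1 ≤ R}
  calc ∫⁻ x, w x * ∫⁻ y in closedBall x R, H y ∂μ ∂μ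
      = ∫⁻ x, ∫⁻ y, S.indicator (fun z => w z.1 * H z.2) (x, y) ∂μ ∂μ := by
        refine lintegral_congr fun x => ?_
        rw [← lintegral_const_mul _ hH, ← lintegral_indicator measurableSet_closedBall]
        rfl
    _ = ∫⁻ y, ∫⁻ x, S.indicator (fun z => w z.1 * H z.2) (x, y) ∂μ ∂μ :=
        lintegral_lintegral_swap (Measurable.aemeasurable
          (((hw.comp measurable_fst).mul (hH.comp measurable_snd)).indicator
            (measurableSet_dist_le R)))
    _ = ∫⁻ y, H y * ∫⁻ x in closedBall y R, w x ∂μ ∂μ := by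
        refine lintegral_congr fun y => ?_
        rw [← lintegral_const_mul _ hw, ← lintegral_indicator measurableSet_closedBall]
        refine lintegral_congr fun x => ?_
        simp only [S, indicator, mem_ofPred_eq, mem_closedBall, dist_comm, mul_comm]

theorem IsDoublingWith.lintegral_mul_setLAverage_le (hμ : IsDoublingWith μ D)
    (hw : Measurable w) (hH : Measurable H) {R : ℝ} (hR : 0 < R) :
    ∫⁻ x, w x * ⨍⁻ y in closedBall x R, H y ∂μ ∂μ ≤
      D * ∫⁻ y, H y * ⨍⁻ x in closedBall y R, w x ∂μ ∂μ := by
  set m : X → ℝ≥0∞ := fun x => μ (closedBall x R)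
  have hHm : Measurable fun y => D * ((m y)⁻¹ * H y) :=
    (((measurable_measure_closedBall R).inv).mul hH).const_mul _
  calc ∫⁻ x, w x * ⨍⁻ y in closedBall x R, H y ∂μ ∂μ
      ≤ ∫⁻ x, w x * ∫⁻ y in closedBall x R, D * ((m y)⁻¹ * H y) ∂μ ∂μ := by
        gcongr with x
        rw [setLAverage_eq, ENNReal.div_eq_inv_mul, ← lintegral_const_mul _ hH]
        refine setLIntegral_mono' measurableSet_closedBall fun y hy => ?_
        rw [← mul_assoc]
        gcongr
        exact hμ.inv_measure_closedBall_le hR (mem_closedBall'.1 hy)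
    _ = ∫⁻ y, D * ((m y)⁻¹ * H y) * ∫⁻ x in closedBall y R, w x ∂μ ∂μ :=
        lintegral_mul_setLIntegral_closedBall_comm hw hHm R
    _ = D * ∫⁻ y, H y * ⨍⁻ x in closedBall y R, w x ∂μ ∂μ := by
        rw [← lintegral_const_mul' _ _ ENNReal.coe_ne_top]
        refine lintegral_congr fun y => ?_
        rw [setLAverage_eq, ENNReal.div_eq_inv_mul]
        ring

end Averages

end DoublingMeasures

section DyadicSums

theorem tsum_zpow_rpow_neg_le {a r : ℝ} (ha : 0 < a) (hr : 0 < r) :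
    ∑' m : ℤ, (if r ≤ (2 : ℝ) ^ m then ENNReal.ofReal (((2 : ℝ) ^ m) ^ (-a)) else 0) ≤
      ENNReal.ofReal (r ^ (-a) * (1 - 2 ^ (-a))⁻¹) := by
  obtain ⟨n, hn⟩ := exists_mem_Ioc_zpow hr (one_lt_two (α := ℝ))
  set f : ℤ → ℝ≥0∞ :=
    fun m => if r ≤ (2 : ℝ) ^ m then ENNReal.ofReal (((2 : ℝ) ^ m) ^ (-a)) else 0
  have hinj : Function.Injective fun k : ℕ => n + 1 + (k : ℤ) :=
    (add_right_injective _).comp Nat.cast_injective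
  have hsupp : Function.support f ⊆ range fun k : ℕ => n + 1 + (k : ℤ) := by
    intro m hm
    have hrm : r ≤ (2 : ℝ) ^ m := not_not.1 fun h => hm (if_neg h)
    have hlt : n < m := (zpow_lt_zpow_iff_right₀ (one_lt_two (α := ℝ))).1 (hn.1.trans_le hrm)
    exact ⟨(m - (n + 1)).toNat, by simp only; omega⟩
  have htwo : (2 : ℝ) ^ (-a) < 1 := Real.rpow_lt_one_of_one_lt_of_neg one_lt_two (by linarith)
  have hterm : ∀ k : ℕ, f (n + 1 + (k : ℤ)) ≤
      ENNReal.ofReal (r ^ (-a)) * ENNReal.ofReal (2 ^ (-a)) ^ k := by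
    intro k
    refine (ite_le_sup _ _ _).trans (max_le ?_ zero_le)
    rw [← ENNReal.ofReal_pow (by positivity), ← ENNReal.ofReal_mul (by positivity),
      zpow_add₀ two_ne_zero, Real.mul_rpow (by positivity) (by positivity), zpow_natCast,
      Real.rpow_pow_comm zero_le_two]
    gcongr ENNReal.ofReal (?_ * _)
    exact Real.rpow_le_rpow_of_nonpos hr hn.2 (by linarith)
  calc ∑' m, f m = ∑' k : ℕ, f (n + 1 + (k : ℤ)) := (hinj.tsum_eq hsupp).symm
    _ ≤ ∑' k : ℕ, ENNReal.ofReal (r ^ (-a)) * ENNReal.ofReal (2 ^ (-a)) ^ k :=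
        ENNReal.tsum_le_tsum hterm
    _ = ENNReal.ofReal (r ^ (-a) * (1 - 2 ^ (-a))⁻¹) := by
        rw [ENNReal.tsum_mul_left, ENNReal.tsum_geometric, ENNReal.ofReal_mul (by positivity),
          ENNReal.ofReal_inv_of_pos (by linarith), ENNReal.ofReal_sub _ (by positivity),
          ENNReal.ofReal_one]

theorem tsum_zpow_rpow_le {a r : ℝ} (ha : 0 < a) (hr : 0 < r) :
    ∑' m : ℤ, (if (2 : ℝ) ^ m < r then ENNReal.ofReal (((2 : ℝ) ^ m) ^ a) else 0) ≤
      ENNReal.ofReal (r ^ a * (1 - 2 ^ (-a))⁻¹) := by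
  have hinv := tsum_zpow_rpow_neg_le ha (inv_pos.2 hr)
  rw [← (Equiv.neg ℤ).tsum_eq, Real.inv_rpow hr.le, Real.rpow_neg hr.le, inv_inv] at hinv
  refine (ENNReal.tsum_le_tsum fun m => ?_).trans hinv
  simp only [Equiv.neg_apply, zpow_neg, Real.rpow_neg (inv_nonneg.2 (zpow_nonneg zero_le_two m)),
    Real.inv_rpow (zpow_nonneg zero_le_two m), inv_inv]
  split_ifs with hlt hle
  · exact le_rfl
  · exact absurd (inv_anti₀ (by positivity) hlt.le) hle
  · exact zero_le
  · exact le_rfl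

theorem tsum_rpow_le_mul_tsum {ι : Type*} {q : ℝ} (hq : 0 < q) {c : ι → ℝ≥0∞}
    (hc₀ : ∀ i, c i ≠ 0) (hc : ∀ i, c i ≠ ∞) (a : ι → ℝ≥0∞) :
    (∑' i, a i) ^ q ≤ (∑' i, c i) ^ q * ∑' i, (c i)⁻¹ ^ q * a i ^ q := by
  set S := ∑' i, (c i)⁻¹ ^ q * a i ^ q
  have hterm : ∀ i, a i ≤ c i * S ^ q⁻¹ := fun i => by
    rw [mul_comm, ← ENNReal.div_le_iff_le_mul (Or.inl (hc₀ i)) (Or.inl (hc i)),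
      ENNReal.le_rpow_inv_iff hq, ENNReal.div_eq_inv_mul, ENNReal.mul_rpow_of_nonneg _ _ hq.le]
    exact ENNReal.le_tsum i
  calc (∑' i, a i) ^ q ≤ (∑' i, c i * S ^ q⁻¹) ^ q := by
        gcongr with i
        exact hterm i
    _ = (∑' i, c i) ^ q * S := by
        rw [ENNReal.tsum_mul_right, ENNReal.mul_rpow_of_nonneg _ _ hq.le,
          ENNReal.rpow_inv_rpow hq.ne']

theorem tsum_min_zpow_div_rpow_le {θ d : ℝ} (hθ : 0 < θ) (hd : 0 < d) :
    ∑' m : ℤ, ENNReal.ofReal (min (((2 : ℝ) ^ m / d) ^ θ) (((2 : ℝ) ^ m / d) ^ (-θ))) ≤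
      ENNReal.ofReal (2 * (1 - 2 ^ (-θ))⁻¹) := by
  have hsplit : ∀ m : ℤ,
      ENNReal.ofReal (min (((2 : ℝ) ^ m / d) ^ θ) (((2 : ℝ) ^ m / d) ^ (-θ))) ≤
        ENNReal.ofReal (d ^ θ) *
          (if d ≤ (2 : ℝ) ^ m then ENNReal.ofReal (((2 : ℝ) ^ m) ^ (-θ)) else 0) +
        ENNReal.ofReal (d ^ (-θ)) *
          (if (2 : ℝ) ^ m < d then ENNReal.ofReal (((2 : ℝ) ^ m) ^ θ) else 0) := by
    intro m
    rcases le_or_gt d ((2 : ℝ) ^ m) with hm | hm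
    · rw [if_pos hm, if_neg hm.not_gt, mul_zero, add_zero, ← ENNReal.ofReal_mul (by positivity)]
      refine ENNReal.ofReal_le_ofReal ((min_le_right _ _).trans_eq ?_)
      rw [Real.div_rpow (by positivity) hd.le, Real.rpow_neg hd.le, div_inv_eq_mul, mul_comm]
    · rw [if_neg hm.not_ge, if_pos hm, mul_zero, zero_add, ← ENNReal.ofReal_mul (by positivity)]
      refine ENNReal.ofReal_le_ofReal ((min_le_left _ _).trans_eq ?_)
      rw [Real.div_rpow (by positivity) hd.le, Real.rpow_neg hd.le, div_eq_inv_mul]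
  have htwo : (2 : ℝ) ^ (-θ) < 1 := Real.rpow_lt_one_of_one_lt_of_neg one_lt_two (by linarith)
  have : 0 < (1 - (2 : ℝ) ^ (-θ))⁻¹ := inv_pos.2 (by linarith)
  refine (ENNReal.tsum_le_tsum hsplit).trans ?_
  rw [ENNReal.tsum_add, ENNReal.tsum_mul_left, ENNReal.tsum_mul_left]
  refine (add_le_add (mul_le_mul_right (tsum_zpow_rpow_neg_le hθ hd) _)
    (mul_le_mul_right (tsum_zpow_rpow_le hθ hd) _)).trans_eq ?_
  rw [← ENNReal.ofReal_mul (by positivity), ← ENNReal.ofReal_mul (by positivity),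
    ← ENNReal.ofReal_add (by positivity) (by positivity), ← mul_assoc, ← mul_assoc,
    ← Real.rpow_add hd, ← Real.rpow_add hd, add_neg_cancel, neg_add_cancel, Real.rpow_zero,
    two_mul, one_mul]

theorem tsum_rpow_le_tsum_dyadic {q θ d : ℝ} (hq : 0 < q) (hθ : 0 < θ) (hd : 0 < d)
    (a : ℤ → ℝ≥0∞) :
    (∑' m, a m) ^ q ≤ ENNReal.ofReal (2 * (1 - 2 ^ (-θ))⁻¹) ^ q *
      ((∑' m : ℤ, ENNReal.ofReal (((2 : ℝ) ^ m / d) ^ (θ * q)) * a m ^ q) +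
        ∑' m : ℤ, ENNReal.ofReal (((2 : ℝ) ^ m / d) ^ (-(θ * q))) * a m ^ q) := by
  set c : ℤ → ℝ := fun m => min (((2 : ℝ) ^ m / d) ^ θ) (((2 : ℝ) ^ m / d) ^ (-θ))
  have hc₀ : ∀ m, 0 < c m := fun m => lt_min (by positivity) (by positivity)
  have hinv : ∀ m, (ENNReal.ofReal (c m))⁻¹ ^ q ≤
      ENNReal.ofReal (((2 : ℝ) ^ m / d) ^ (θ * q)) +
        ENNReal.ofReal (((2 : ℝ) ^ m / d) ^ (-(θ * q))) := by
    intro m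
    have hb : (0 : ℝ) < (2 : ℝ) ^ m / d := by positivity
    rw [← ENNReal.ofReal_inv_of_pos (hc₀ m), ENNReal.ofReal_rpow_of_pos (inv_pos.2 (hc₀ m)),
      ← ENNReal.ofReal_add (by positivity) (by positivity)]
    refine ENNReal.ofReal_le_ofReal ?_
    rcases min_choice (((2 : ℝ) ^ m / d) ^ θ) (((2 : ℝ) ^ m / d) ^ (-θ)) with h | h
    · rw [show c m = _ from h, ← Real.rpow_neg hb.le, ← Real.rpow_mul hb.le, neg_mul]
      exact le_add_of_nonneg_left (by positivity)
    · rw [show c m = _ from h, ← Real.rpow_neg hb.le, ← Real.rpow_mul hb.le, neg_neg]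
      exact le_add_of_nonneg_right (by positivity)
  calc (∑' m, a m) ^ q ≤ (∑' m, ENNReal.ofReal (c m)) ^ q *
        ∑' m, (ENNReal.ofReal (c m))⁻¹ ^ q * a m ^ q :=
        tsum_rpow_le_mul_tsum hq (fun m => (ENNReal.ofReal_pos.2 (hc₀ m)).ne')
          (fun m => ENNReal.ofReal_ne_top) a
    _ ≤ _ := by
        gcongr
        · exact tsum_min_zpow_div_rpow_le hθ hd
        · rw [← ENNReal.tsum_add]
          exact ENNReal.tsum_le_tsum fun m => by
            rw [← add_mul]
            exact mul_le_mul_left (hinv m) _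

end DyadicSums

section DistanceWeights

open Filter Topology

variable {X : Type*} [MetricSpace X] {E : Set X}

/-- The weight `dist(·, E) ^ γ`, set to zero on `E`. Integrals over `Eᶜ` against powers of the
distance to `E` thus become integrals over the whole space, for exponents of either sign. -/
noncomputable def distWeight (E : Set X) (γ : ℝ) : X → ℝ≥0∞ :=
  Eᶜ.indicator fun x => infEDist x E ^ γ

theorem distWeight_of_mem {γ : ℝ} {x : X} (hx : x ∈ E) : distWeight E γ x = 0 :=
  indicator_of_notMem (not_not.2 hx) _

theorem distWeight_rpow {γ a : ℝ} (ha : 0 < a) (x : X) :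
    distWeight E γ x ^ a = distWeight E (γ * a) x := by
  by_cases hx : x ∈ E
  · rw [distWeight_of_mem hx, distWeight_of_mem hx, ENNReal.zero_rpow_of_pos ha]
  · simp only [distWeight, indicator_of_mem (mem_compl hx), ENNReal.rpow_mul]

theorem infEDist_ne_zero (hEc : IsClosed E) {x : X} (hx : x ∉ E) : infEDist x E ≠ 0 :=
  (mem_iff_infEDist_zero_of_closed hEc).not.1 hx

theorem distWeight_mul (hEc : IsClosed E) (hE : E.Nonempty) (γ₁ γ₂ : ℝ) (x : X) :
    distWeight E γ₁ x * distWeight E γ₂ x = distWeight E (γ₁ + γ₂) x := by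
  by_cases hx : x ∈ E
  · simp only [distWeight_of_mem hx, mul_zero]
  · simp only [distWeight, indicator_of_mem (mem_compl hx)]
    rw [ENNReal.rpow_add _ _ (infEDist_ne_zero hEc hx) (infEDist_ne_top hE)]

theorem distWeight_eq_ofReal (hEc : IsClosed E) (hE : E.Nonempty) {γ : ℝ} {x : X} (hx : x ∉ E) :
    distWeight E γ x = ENNReal.ofReal (infDist x E ^ γ) := by
  rw [distWeight, indicator_of_mem (mem_compl hx), infDist,
    ← ENNReal.ofReal_rpow_of_pos (ENNReal.toReal_pos (infEDist_ne_zero hEc hx)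
      (infEDist_ne_top hE)), ENNReal.ofReal_toReal (infEDist_ne_top hE)]

theorem ofReal_infDist_rpow_mul_distWeight (hEc : IsClosed E) (hE : E.Nonempty) (a γ : ℝ) (x : X) :
    ENNReal.ofReal (infDist x E ^ a) * distWeight E γ x = distWeight E (a + γ) x := by
  by_cases hx : x ∈ E
  · simp only [distWeight_of_mem hx, mul_zero]
  · rw [← distWeight_eq_ofReal hEc hE hx, distWeight_mul hEc hE]

theorem infDist_le_three_mul {x y : X} {R : ℝ} (hx : x ∈ closedBall y R)
    (hy : infDist y E ≤ 2 * R) : infDist x E ≤ 3 * R := by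
  linarith [infDist_le_infDist_add_dist (s := E) (x := x) (y := y), mem_closedBall.1 hx]

theorem distWeight_neg_le_tsum_indicator_thickening (hEc : IsClosed E) (hE : E.Nonempty)
    {s R : ℝ} (hs : 0 ≤ s) {x : X} (hx : infDist x E ≤ 3 * R) :
    distWeight E (-s) x ≤ ∑' k : ℕ, (thickening ((1 / 2) ^ k * (6 * R)) E).indicator
      (fun _ => ENNReal.ofReal (((1 / 2) ^ k * R) ^ (-s))) x := by
  by_cases hxE : x ∈ E
  · simp [distWeight_of_mem hxE]
  have hpos : 0 < infDist x E := (hEc.notMem_iff_infDist_pos hE).1 hxE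
  have hR : 0 < R := by linarith
  obtain ⟨k, hk, hk'⟩ := exists_nat_pow_near_of_lt_one (x := infDist x E / (3 * R))
    (y := (1 / 2 : ℝ)) (by positivity) ((div_le_one (by positivity)).2 hx)
    (by norm_num) (by norm_num)
  rw [lt_div_iff₀ (by positivity), pow_succ] at hk
  rw [div_le_iff₀ (by positivity)] at hk'
  have hkR : 0 < (1 / 2) ^ k * R := by positivity
  refine le_trans ?_ (ENNReal.le_tsum k)
  rw [indicator_of_mem ((mem_thickening_iff_infDist_lt hE).2 (by linarith)),
    distWeight_eq_ofReal hEc hE hxE]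
  exact ENNReal.ofReal_le_ofReal
    (Real.rpow_le_rpow_of_nonpos hkR (by linarith) (by linarith))

variable [MeasurableSpace X] [BorelSpace X] {μ : Measure X}

theorem measurable_distWeight (hEc : IsClosed E) (γ : ℝ) : Measurable (distWeight E γ) :=
  (measurable_infEDist.pow_const γ).indicator hEc.measurableSet.compl

theorem setLIntegral_compl_mul_infEDist_rpow (hEc : IsClosed E) (f : X → ℝ≥0∞) (γ : ℝ) :
    ∫⁻ x in Eᶜ, f x * infEDist x E ^ γ ∂μ = ∫⁻ x, f x * distWeight E γ x ∂μ := by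
  rw [← lintegral_indicator hEc.measurableSet.compl]
  exact lintegral_congr fun x => indicator_mul_right _ _ _

end DistanceWeights

section Codimension

variable {X : Type*} [MetricSpace X] [MeasurableSpace X] {μ : Measure X} {E : Set X}
  {D C : ℝ≥0} {t : ℝ}

/-- The neighbourhoods of `E` have relative measure at most `C * (r / R) ^ t` in balls centred on
`E`: the estimate in the definition of the lower Assouad codimension. -/
def HasCodimBound (μ : Measure X) (E : Set X) (t : ℝ) (C : ℝ≥0) : Prop :=
  ∀ x ∈ E, ∀ r R : ℝ, 0 < r → r < R →
    μ (thickening r E ∩ closedBall x R) / μ (closedBall x R) ≤ C * ENNReal.ofReal ((r / R) ^ t)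

/-- The Aikawa condition: the mean values of `dist(·, E) ^ (-s)` over balls `B(y, R)` with
`dist(y, E) ≤ 2 * R` are at most `K * R ^ (-s)`. -/
def AikawaBound (μ : Measure X) (E : Set X) (s : ℝ) (K : ℝ≥0) : Prop :=
  ∀ (y : X) (R : ℝ), 0 < R → infDist y E ≤ 2 * R →
    ∫⁻ x in closedBall y R, distWeight E (-s) x ∂μ ≤
      K * ENNReal.ofReal (R ^ (-s)) * μ (closedBall y R)

theorem exists_hasCodimBound {a : ℝ} (ha : ENNReal.ofReal a < lowerAssouadCodim μ E) :
    ∃ t C, a < t ∧ HasCodimBound μ E t C := by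
  simp only [lowerAssouadCodim, lt_iSup_iff] at ha
  obtain ⟨t, ⟨C, hC⟩, hat⟩ := ha
  exact ⟨t, C, (Real.le_coe_toNNReal a).trans_lt (ENNReal.coe_lt_coe.1 hat), hC⟩

theorem HasCodimBound.exists_measure_thickening_inter_closedBall_le (hcodim : HasCodimBound μ E t C)
    (hμ : IsDoublingWith μ D) (hE : E.Nonempty) :
    ∃ K : ℝ≥0, ∀ (y : X) (r R : ℝ), 0 < r → r < 8 * R → infDist y E ≤ 2 * R →
      μ (thickening r E ∩ closedBall y R) ≤
        K * ENNReal.ofReal ((r / (8 * R)) ^ t) * μ (closedBall y R) := by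
  obtain ⟨K, hK⟩ := hμ.exists_measure_closedBall_le 8
  refine ⟨C * K, fun y r R hr hrR hy => ?_⟩
  have hR : 0 < R := by linarith
  obtain ⟨z, hz, hyz⟩ := (infDist_lt_iff hE).1 (show infDist y E < 3 * R by linarith)
  have hthick := hcodim z hz r (8 * R) hr hrR
  rw [ENNReal.div_le_iff (hμ.pos z (by positivity)).ne' (hμ.lt_top z (by positivity)).ne] at hthick
  calc μ (thickening r E ∩ closedBall y R)
      ≤ μ (thickening r E ∩ closedBall z (8 * R)) :=
        measure_mono (inter_subset_inter_right _ (closedBall_subset_closedBall' (by linarith)))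
    _ ≤ C * ENNReal.ofReal ((r / (8 * R)) ^ t) * μ (closedBall z (8 * R)) := hthick
    _ ≤ C * ENNReal.ofReal ((r / (8 * R)) ^ t) * (K * μ (closedBall y R)) := by
        gcongr
        exact hK y z R hR (by linarith)
    _ = _ := by
        rw [ENNReal.coe_mul]
        ring

theorem HasCodimBound.exists_rpow_mul_measure_thickening_le (hcodim : HasCodimBound μ E t C)
    (hμ : IsDoublingWith μ D) (hE : E.Nonempty) {s : ℝ} (ht : 0 ≤ t) :
    ∃ K : ℝ≥0, ∀ (y : X) (R : ℝ) (k : ℕ), 0 < R → infDist y E ≤ 2 * R →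
      ENNReal.ofReal (((1 / 2) ^ k * R) ^ (-s)) *
        μ (thickening ((1 / 2) ^ k * (6 * R)) E ∩ closedBall y R) ≤
      K * ENNReal.ofReal (R ^ (-s)) * μ (closedBall y R) *
        ENNReal.ofReal ((1 / 2) ^ (t - s)) ^ k := by
  obtain ⟨K, hK⟩ := hcodim.exists_measure_thickening_inter_closedBall_le hμ hE
  refine ⟨K, fun y R k hR hy => ?_⟩
  have hk : (0 : ℝ) < (1 / 2) ^ k := by positivity
  have hk₁ : (1 / 2 : ℝ) ^ k ≤ 1 := pow_le_one₀ (by norm_num) (by norm_num)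
  have hreal : ((1 / 2) ^ k * R) ^ (-s) * ((1 / 2) ^ k * (6 * R) / (8 * R)) ^ t ≤
      R ^ (-s) * ((1 / 2) ^ (t - s)) ^ k := by
    have hpow : ((1 / 2 : ℝ) ^ (t - s)) ^ k = ((1 / 2 : ℝ) ^ k) ^ (-s) * ((1 / 2 : ℝ) ^ k) ^ t := by
      rw [← Real.rpow_add hk, Real.rpow_pow_comm (by norm_num), neg_add_eq_sub]
    rw [hpow, Real.mul_rpow hk.le hR.le, mul_comm (_ ^ (-s)) (R ^ (-s)), mul_assoc]
    gcongr
    rw [div_le_iff₀ (by positivity)]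
    nlinarith
  calc _ ≤ ENNReal.ofReal (((1 / 2) ^ k * R) ^ (-s)) *
        (K * ENNReal.ofReal (((1 / 2) ^ k * (6 * R) / (8 * R)) ^ t) * μ (closedBall y R)) := by
        gcongr
        exact hK y _ R (by positivity) (by nlinarith) hy
    _ = K * ENNReal.ofReal (((1 / 2) ^ k * R) ^ (-s) * ((1 / 2) ^ k * (6 * R) / (8 * R)) ^ t) *
          μ (closedBall y R) := by
        rw [ENNReal.ofReal_mul (by positivity)]
        ring
    _ ≤ K * ENNReal.ofReal (R ^ (-s) * ((1 / 2) ^ (t - s)) ^ k) * μ (closedBall y R) := by gcongr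
    _ = _ := by
        rw [ENNReal.ofReal_mul (by positivity), ENNReal.ofReal_pow (by positivity)]
        ring

variable [BorelSpace X]

theorem HasCodimBound.exists_aikawaBound (hcodim : HasCodimBound μ E t C)
    (hμ : IsDoublingWith μ D) (hEc : IsClosed E) (hE : E.Nonempty) {s : ℝ} (hs : 0 ≤ s)
    (hst : s < t) : ∃ K, AikawaBound μ E s K := by
  obtain ⟨K, hK⟩ := hcodim.exists_rpow_mul_measure_thickening_le hμ hE (s := s) (hs.trans hst.le)
  have hρ : ENNReal.ofReal ((1 / 2) ^ (t - s)) < 1 :=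
    ENNReal.ofReal_lt_one.2 (Real.rpow_lt_one (by norm_num) (by norm_num) (by linarith))
  lift (1 - ENNReal.ofReal ((1 / 2) ^ (t - s)))⁻¹ to ℝ≥0 using
    ENNReal.inv_ne_top.2 (tsub_pos_of_lt hρ).ne' with Γ hΓ
  refine ⟨K * Γ, fun y R hR hy => ?_⟩
  calc ∫⁻ x in closedBall y R, distWeight E (-s) x ∂μ
      ≤ ∫⁻ x in closedBall y R, ∑' k : ℕ, (thickening ((1 / 2) ^ k * (6 * R)) E).indicator
          (fun _ => ENNReal.ofReal (((1 / 2) ^ k * R) ^ (-s))) x ∂μ :=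
        setLIntegral_mono' measurableSet_closedBall fun x hx =>
          distWeight_neg_le_tsum_indicator_thickening hEc hE hs (infDist_le_three_mul hx hy)
    _ = ∑' k : ℕ, ENNReal.ofReal (((1 / 2) ^ k * R) ^ (-s)) *
          μ (thickening ((1 / 2) ^ k * (6 * R)) E ∩ closedBall y R) := by
        rw [lintegral_tsum fun k =>
          (measurable_const.indicator isOpen_thickening.measurableSet).aemeasurable]
        refine tsum_congr fun k => ?_
        rw [lintegral_indicator_const isOpen_thickening.measurableSet,
          Measure.restrict_apply isOpen_thickening.measurableSet]
    _ ≤ ∑' k : ℕ, K * ENNReal.ofReal (R ^ (-s)) * μ (closedBall y R) *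
          ENNReal.ofReal ((1 / 2) ^ (t - s)) ^ k :=
        ENNReal.tsum_le_tsum fun k => hK y R k hR hy
    _ = _ := by
        rw [ENNReal.tsum_mul_left, ENNReal.tsum_geometric, ← hΓ, ENNReal.coe_mul]
        ring

theorem AikawaBound.mono {K : ℝ≥0} {s s₁ : ℝ} (h : AikawaBound μ E s₁ K) (hEc : IsClosed E)
    (hE : E.Nonempty) (hs : 0 ≤ s) (hs₁ : s ≤ s₁) : AikawaBound μ E s (3 ^ s₁ * K) := by
  intro y R hR hy
  have hweight : ∀ x ∈ closedBall y R, distWeight E (-s) x ≤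
      ENNReal.ofReal ((3 * R) ^ (s₁ - s)) * distWeight E (-s₁) x := by
    intro x hx
    rw [show -s = s₁ - s + -s₁ by ring, ← ofReal_infDist_rpow_mul_distWeight hEc hE]
    gcongr
    · exact infDist_nonneg
    · exact infDist_le_three_mul hx hy
  have hscale : (3 * R) ^ (s₁ - s) * R ^ (-s₁) ≤ 3 ^ s₁ * R ^ (-s) := by
    rw [Real.mul_rpow (by norm_num) hR.le, mul_assoc, ← Real.rpow_add hR,
      show s₁ - s + -s₁ = -s by ring]
    gcongr
    · norm_num
    · linarith
  calc ∫⁻ x in closedBall y R, distWeight E (-s) x ∂μ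
      ≤ ENNReal.ofReal ((3 * R) ^ (s₁ - s)) *
          ∫⁻ x in closedBall y R, distWeight E (-s₁) x ∂μ := by
        rw [← lintegral_const_mul' _ _ ENNReal.ofReal_ne_top]
        exact setLIntegral_mono' measurableSet_closedBall hweight
    _ ≤ ENNReal.ofReal ((3 * R) ^ (s₁ - s)) *
          (K * ENNReal.ofReal (R ^ (-s₁)) * μ (closedBall y R)) := by
        gcongr
        exact h y R hR hy
    _ = ENNReal.ofReal ((3 * R) ^ (s₁ - s) * R ^ (-s₁)) * (K * μ (closedBall y R)) := by
        rw [ENNReal.ofReal_mul (by positivity)]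
        ring
    _ ≤ ENNReal.ofReal (3 ^ s₁ * R ^ (-s)) * (K * μ (closedBall y R)) := by gcongr
    _ = _ := by
        have hthree : ENNReal.ofReal (3 ^ s₁) = ((3 ^ s₁ : ℝ≥0) : ℝ≥0∞) :=
          ENNReal.ofReal_eq_coe_nnreal (NNReal.coe_nonneg (3 ^ s₁))
        rw [ENNReal.ofReal_mul (by positivity), ENNReal.coe_mul, hthree]
        ring

end Codimension

section Telescoping

open Filter Topology

theorem edist_le_tsum_edist_add_one {Y : Type*} [PseudoEMetricSpace Y] {a : ℤ → Y} {b c : Y}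
    (hb : Tendsto (fun n : ℕ => a (-n)) atTop (𝓝 b)) (hc : Tendsto (fun n : ℕ => a n) atTop (𝓝 c)) :
    edist b c ≤ ∑' m : ℤ, edist (a m) (a (m + 1)) := by
  refine le_of_tendsto' (hb.edist hc) fun N => ?_
  have hinj : Function.Injective fun i : ℕ => -(N : ℤ) + i :=
    (add_right_injective _).comp Nat.cast_injective
  calc edist (a (-N)) (a N)
      = edist (a (-(N : ℤ) + (0 : ℕ))) (a (-(N : ℤ) + (2 * N : ℕ))) := by
        congr 2 <;> push_cast <;> ring
    _ ≤ ∑ i ∈ Finset.range (2 * N), edist (a (-N + i)) (a (-N + (i + 1 : ℕ))) :=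
        edist_le_range_sum_edist (fun i : ℕ => a (-N + i)) (2 * N)
    _ = ∑ i ∈ Finset.range (2 * N), edist (a (-N + i)) (a (-N + i + 1)) := by
        simp only [Nat.cast_add, Nat.cast_one, add_assoc]
    _ ≤ ∑' i : ℕ, edist (a (-N + i)) (a (-N + i + 1)) := ENNReal.sum_le_tsum _
    _ ≤ ∑' m : ℤ, edist (a m) (a (m + 1)) :=
        ENNReal.tsum_comp_le_tsum_of_injective hinj fun m => edist (a m) (a (m + 1))

theorem edist_setAverage_le {X : Type*} [MeasurableSpace X] {μ : Measure X} {B : Set X}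
    {f : X → ℝ} (hB₀ : μ B ≠ 0) (hB : μ B ≠ ∞) (hf : IntegrableOn f B μ) (c : ℝ) :
    edist (⨍ z in B, f z ∂μ) c ≤ ⨍⁻ z in B, ‖f z - c‖ₑ ∂μ := by
  have hfin : IsFiniteMeasure (μ.restrict B) := ⟨by simpa using hB.lt_top⟩
  have hsub : (⨍ z in B, f z ∂μ) - c = ⨍ z in B, (f z - c) ∂μ := by
    rw [setAverage_eq, setAverage_eq, integral_sub hf (integrable_const c), smul_sub,
      ← setAverage_eq μ (fun _ : X => c) B, setAverage_const hB₀ hB]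
  rw [edist_eq_enorm_sub, hsub]
  exact enorm_integral_le_lintegral_enorm _

variable {X : Type*} [MetricSpace X] [MeasurableSpace X] {μ : Measure X} {D : ℝ≥0} {f : X → ℝ}

theorem IsDoublingWith.edist_setAverage_two_mul_le (hμ : IsDoublingWith μ D)
    (hf : Integrable f μ) (x : X) {r : ℝ} (hr : 0 < r) :
    edist (⨍ z in closedBall x r, f z ∂μ) (⨍ z in closedBall x (2 * r), f z ∂μ) ≤
      D * ⨍⁻ z in closedBall x (2 * r), ‖f z - ⨍ w in closedBall x (2 * r), f w ∂μ‖ₑ ∂μ := by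
  have hr₂ : 0 < 2 * r := by positivity
  set c := ⨍ w in closedBall x (2 * r), f w ∂μ
  set I := ∫⁻ z in closedBall x (2 * r), ‖f z - c‖ₑ ∂μ
  refine (edist_setAverage_le (hμ.pos x hr).ne' (hμ.lt_top x hr).ne hf.integrableOn c).trans ?_
  rw [setLAverage_eq, setLAverage_eq]
  refine ENNReal.div_le_of_le_mul ?_
  calc ∫⁻ z in closedBall x r, ‖f z - c‖ₑ ∂μ
      ≤ I := lintegral_mono_set (closedBall_subset_closedBall (by linarith))
    _ = I / μ (closedBall x (2 * r)) * μ (closedBall x (2 * r)) :=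
        (ENNReal.div_mul_cancel (hμ.pos x hr₂).ne' (hμ.lt_top x hr₂).ne).symm
    _ ≤ I / μ (closedBall x (2 * r)) * (D * μ (closedBall x r)) := by
        gcongr
        exact hμ.two_mul_le x hr
    _ = D * (I / μ (closedBall x (2 * r))) * μ (closedBall x r) := by ring

theorem IsPosFiniteOnBalls.tendsto_setAverage_closedBall_nhds [BorelSpace X]
    (hμ : IsPosFiniteOnBalls μ) (hf : Integrable f μ) {x : X} (hx : ContinuousAt f x) :
    Tendsto (fun r => ⨍ z in closedBall x r, f z ∂μ) (𝓝[>] 0) (𝓝 (f x)) := by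
  rw [nhds_basis_closedBall.tendsto_right_iff]
  intro ε hε
  obtain ⟨δ, hδ, hball⟩ :=
    nhds_basis_closedBall.eventually_iff.1 (hx.eventually (closedBall_mem_nhds _ hε))
  filter_upwards [Ioc_mem_nhdsGT hδ] with r hr
  refine (convex_closedBall _ _).set_average_mem isClosed_closedBall (hμ.pos x hr.1).ne'
    (hμ.lt_top x hr.1).ne ?_ hf.integrableOn
  exact ae_restrict_of_forall_mem measurableSet_closedBall fun z hz =>
    hball (closedBall_subset_closedBall hr.2 hz)

theorem tendsto_setAverage_closedBall_zero (hf : Integrable f μ) (hμ : μ univ = ∞) (x : X)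
    {R : ℕ → ℝ} (hR : Monotone R) (hR' : Tendsto R atTop atTop) :
    Tendsto (fun n => ⨍ z in closedBall x (R n), f z ∂μ) atTop (𝓝 0) := by
  have hlim : Tendsto (fun n => (∫⁻ z, ‖f z‖ₑ ∂μ) / μ (closedBall x (R n))) atTop (𝓝 0) := by
    have hball := tendsto_measure_closedBall (μ := μ) x hR hR'
    rw [hμ] at hball
    simpa only [ENNReal.div_top] using ENNReal.Tendsto.const_div hball (Or.inr hf.2.ne)
  refine tendsto_zero_iff_enorm_tendsto_zero.2
    (tendsto_of_tendsto_of_tendsto_of_le_of_le tendsto_const_nhds hlim (fun _ => zero_le) ?_)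
  intro n
  calc ‖⨍ z in closedBall x (R n), f z ∂μ‖ₑ
      ≤ ⨍⁻ z in closedBall x (R n), ‖f z‖ₑ ∂μ := enorm_integral_le_lintegral_enorm _
    _ ≤ (∫⁻ z, ‖f z‖ₑ ∂μ) / μ (closedBall x (R n)) := by
        rw [setLAverage_eq]
        gcongr
        exact Measure.restrict_le_self

theorem SupportsPoincare.exists_enorm_le_tsum [BorelSpace X] {q : ℝ}
    (hP : SupportsPoincare μ q) (hμ : IsDoublingWith μ D)
    (hX : ¬ Bornology.IsBounded (univ : Set X)) :
    ∃ (K : ℝ≥0) (lam : ℝ), 1 ≤ lam ∧ ∀ (v : X → ℝ) (h : X → ℝ≥0∞), Continuous v →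
      Integrable v μ → IsUpperGradientOn h v univ →
      ∀ x, ‖v x‖ₑ ≤ K * ∑' m : ℤ, ENNReal.ofReal ((2 : ℝ) ^ m) *
        (⨍⁻ y in closedBall x (lam * 2 ^ m), h y ^ q ∂μ) ^ (1 / q) := by
  obtain ⟨C, lam, hlam, hP⟩ := hP
  refine ⟨D * C, lam, hlam, fun v h hv hvi hh x => ?_⟩
  set a : ℤ → ℝ := fun m => ⨍ z in closedBall x (2 ^ m), v z ∂μ
  set T : ℤ → ℝ≥0∞ := fun m => ENNReal.ofReal ((2 : ℝ) ^ m) *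
    (⨍⁻ y in closedBall x (lam * 2 ^ m), h y ^ q ∂μ) ^ (1 / q)
  have hstep : ∀ m, edist (a m) (a (m + 1)) ≤ D * C * T (m + 1) := by
    intro m
    have hdouble : (2 : ℝ) ^ (m + 1) = 2 * 2 ^ m := by rw [zpow_add_one₀ two_ne_zero, mul_comm]
    calc edist (a m) (a (m + 1))
        ≤ D * ⨍⁻ z in closedBall x (2 ^ (m + 1)), ‖v z - a (m + 1)‖ₑ ∂μ := by
          simp only [a, hdouble]
          exact hμ.edist_setAverage_two_mul_le hvi x (by positivity)
      _ ≤ D * (C * ENNReal.ofReal (2 ^ (m + 1)) *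
            (⨍⁻ y in closedBall x (lam * 2 ^ (m + 1)), h y ^ q ∂μ) ^ (1 / q)) := by
          gcongr
          exact hP v h hv.measurable (fun _ _ => hvi.integrableOn) hh x _ (by positivity)
      _ = D * C * T (m + 1) := by ring
  have hsmall : Tendsto (fun n : ℕ => a (-n)) atTop (𝓝 (v x)) := by
    refine (hμ.tendsto_setAverage_closedBall_nhds hvi hv.continuousAt).comp
      (tendsto_nhdsWithin_iff.2 ⟨?_, .of_forall fun n => mem_Ioi.2 (by positivity)⟩)
    simpa only [zpow_neg, zpow_natCast, ← inv_pow] using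
      tendsto_pow_atTop_nhds_zero_of_lt_one (r := (2 : ℝ)⁻¹) (by norm_num) (by norm_num)
  have hlarge : Tendsto (fun n : ℕ => a n) atTop (𝓝 0) := by
    simpa only [a, zpow_natCast] using tendsto_setAverage_closedBall_zero hvi
      (hμ.measure_univ_eq_top hX) x (pow_right_mono₀ one_le_two)
      (tendsto_pow_atTop_atTop_of_one_lt (one_lt_two (α := ℝ)))
  calc ‖v x‖ₑ = edist (v x) 0 := (edist_zero_right _).symm
    _ ≤ ∑' m : ℤ, edist (a m) (a (m + 1)) := edist_le_tsum_edist_add_one hsmall hlarge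
    _ ≤ ∑' m : ℤ, D * C * T (m + 1) := ENNReal.tsum_le_tsum hstep
    _ = (D * C : ℝ≥0) * ∑' m, T m := by
        rw [ENNReal.tsum_mul_left, ← (Equiv.addRight (1 : ℤ)).tsum_eq T, ENNReal.coe_mul]
        rfl

end Telescoping

section DyadicAverages

theorem lintegral_mul_tsum_const_mul {ι Y : Type*} [Countable ι] [MeasurableSpace Y]
    {μ : Measure Y} {w : Y → ℝ≥0∞} {F : ι → Y → ℝ≥0∞} {c : ι → ℝ≥0∞} (hw : Measurable w)
    (hF : ∀ i, Measurable (F i)) (hc : ∀ i, c i ≠ ∞) :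
    ∫⁻ y, w y * ∑' i, c i * F i y ∂μ = ∑' i, c i * ∫⁻ y, w y * F i y ∂μ := by
  have hwF : ∀ i, Measurable fun y => c i * (w y * F i y) := fun i =>
    (hw.mul (hF i)).const_mul _
  simp only [← ENNReal.tsum_mul_left, mul_left_comm (w _)]
  rw [lintegral_tsum fun i => (hwF i).aemeasurable]
  exact tsum_congr fun i => lintegral_const_mul' _ _ (hc i)

variable {X : Type*} [MetricSpace X] [MeasurableSpace X] {μ : Measure X} {E : Set X} {K : ℝ≥0}
  {y : X}

theorem AikawaBound.setLAverage_distWeight_neg_le {s R : ℝ} (h : AikawaBound μ E s K)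
    (hR : 0 < R) (hy : infDist y E ≤ 2 * R) :
    ⨍⁻ x in closedBall y R, distWeight E (-s) x ∂μ ≤ K * ENNReal.ofReal (R ^ (-s)) := by
  rw [setLAverage_eq]
  exact ENNReal.div_le_of_le_mul (h y R hR hy)

variable [BorelSpace X]

theorem setLAverage_distWeight_neg_le_of_two_mul_le (hEc : IsClosed E) (hE : E.Nonempty)
    {s R : ℝ} (hs : 0 ≤ s) (hR : 0 < R) (hy : 2 * R ≤ infDist y E) :
    ⨍⁻ x in closedBall y R, distWeight E (-s) x ∂μ ≤ ENNReal.ofReal ((infDist y E / 2) ^ (-s)) := by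
  rw [setLAverage_eq]
  refine ENNReal.div_le_of_le_mul ?_
  rw [← setLIntegral_const]
  refine setLIntegral_mono' measurableSet_closedBall fun x hx => ?_
  have hdist : infDist y E / 2 ≤ infDist x E := by
    linarith [infDist_le_infDist_add_dist (s := E) (x := y) (y := x), mem_closedBall'.1 hx]
  have hxE : x ∉ E := (hEc.notMem_iff_infDist_pos hE).2 (by linarith)
  rw [distWeight_eq_ofReal hEc hE hxE]
  exact ENNReal.ofReal_le_ofReal
    (Real.rpow_le_rpow_of_nonpos (by linarith) hdist (by linarith))

theorem AikawaBound.tsum_rpow_mul_setLAverage_le {α β lam ρ : ℝ} (h : AikawaBound μ E (α - β) K)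
    (hEc : IsClosed E) (hE : E.Nonempty) (hα : 0 < α) (hβ : β < 0) (hlam : 1 ≤ lam) (hρ : 0 < ρ)
    (hy : infDist y E = 2 * lam * ρ) :
    ∑' m : ℤ, ENNReal.ofReal (((2 : ℝ) ^ m) ^ α) *
        ⨍⁻ x in closedBall y (lam * 2 ^ m), distWeight E (β - α) x ∂μ ≤
      (K * ENNReal.ofReal (1 - 2 ^ β)⁻¹ + ENNReal.ofReal (1 - 2 ^ (-α))⁻¹) *
        ENNReal.ofReal (ρ ^ β) := by
  have hterm : ∀ m : ℤ, ENNReal.ofReal (((2 : ℝ) ^ m) ^ α) *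
        ⨍⁻ x in closedBall y (lam * 2 ^ m), distWeight E (β - α) x ∂μ ≤
      K * (if ρ ≤ (2 : ℝ) ^ m then ENNReal.ofReal (((2 : ℝ) ^ m) ^ (-(-β))) else 0) +
      ENNReal.ofReal (ρ ^ (β - α)) *
        (if (2 : ℝ) ^ m < ρ then ENNReal.ofReal (((2 : ℝ) ^ m) ^ α) else 0) := by
    intro m
    have hm : (0 : ℝ) < 2 ^ m := by positivity
    rw [← neg_sub α β, neg_neg]
    rcases le_or_gt ρ ((2 : ℝ) ^ m) with hρm | hρm
    · rw [if_pos hρm, if_neg hρm.not_gt, mul_zero, add_zero]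
      calc _ ≤ ENNReal.ofReal (((2 : ℝ) ^ m) ^ α) *
            (K * ENNReal.ofReal ((2 ^ m) ^ (-(α - β)))) := by
            gcongr
            refine (h.setLAverage_distWeight_neg_le (by positivity) ?_).trans ?_
            · rw [hy, mul_assoc]
              gcongr
            · refine mul_le_mul_right (ENNReal.ofReal_le_ofReal ?_) _
              exact Real.rpow_le_rpow_of_nonpos hm (le_mul_of_one_le_left hm.le hlam)
                (by linarith)
        _ = K * ENNReal.ofReal ((2 ^ m) ^ β) := by
            rw [mul_left_comm, ← ENNReal.ofReal_mul (by positivity), ← Real.rpow_add hm]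
            congr 3
            ring
    · rw [if_neg hρm.not_ge, if_pos hρm, mul_zero, zero_add, mul_comm]
      gcongr
      have hfar : 2 * (lam * 2 ^ m) ≤ infDist y E := by
        rw [hy, mul_assoc]
        gcongr
      refine (setLAverage_distWeight_neg_le_of_two_mul_le hEc hE (by linarith) (by positivity)
        hfar).trans (ENNReal.ofReal_le_ofReal ?_)
      exact Real.rpow_le_rpow_of_nonpos hρ (by nlinarith) (by linarith)
  calc _ ≤ _ := ENNReal.tsum_le_tsum hterm
    _ ≤ K * ENNReal.ofReal (ρ ^ (-(-β)) * (1 - 2 ^ (-(-β)))⁻¹) +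
          ENNReal.ofReal (ρ ^ (β - α)) * ENNReal.ofReal (ρ ^ α * (1 - 2 ^ (-α))⁻¹) := by
        rw [ENNReal.tsum_add, ENNReal.tsum_mul_left, ENNReal.tsum_mul_left]
        gcongr
        · exact tsum_zpow_rpow_neg_le (by linarith) hρ
        · exact tsum_zpow_rpow_le hα hρ
    _ = _ := by
        rw [neg_neg, ← ENNReal.ofReal_mul (by positivity), ← mul_assoc, ← Real.rpow_add hρ,
          sub_add_cancel, ENNReal.ofReal_mul (by positivity), ENNReal.ofReal_mul (by positivity)]
        ring

theorem AikawaBound.exists_tsum_rpow_mul_setLAverage_le {s α lam : ℝ} (h : AikawaBound μ E s K)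
    (hEc : IsClosed E) (hE : E.Nonempty) (hα : 0 < α) (hlam : 1 ≤ lam) :
    ∃ K' : ℝ≥0, ∀ β < 0, α - β ≤ s → ∀ y ∉ E,
      ∑' m : ℤ, ENNReal.ofReal (((2 : ℝ) ^ m) ^ α) *
          ⨍⁻ x in closedBall y (lam * 2 ^ m), distWeight E (β - α) x ∂μ ≤
        K' * ENNReal.ofReal (1 - 2 ^ β)⁻¹ * distWeight E β y := by
  refine ⟨(3 ^ s * K + Real.toNNReal (1 - 2 ^ (-α))⁻¹) * ((2 * lam) ^ s).toNNReal,
    fun β hβ hs y hy => ?_⟩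
  have hd : 0 < infDist y E := (hEc.notMem_iff_infDist_pos hE).1 hy
  have hinv : 1 ≤ ENNReal.ofReal (1 - 2 ^ β)⁻¹ := by
    have hpos : (0 : ℝ) < 2 ^ β := by positivity
    have hlt : (2 : ℝ) ^ β < 1 := Real.rpow_lt_one_of_one_lt_of_neg one_lt_two hβ
    exact ENNReal.one_le_ofReal.2 ((one_le_inv₀ (by linarith)).2 (by linarith))
  have hρ : (infDist y E / (2 * lam)) ^ β ≤ (2 * lam) ^ s * infDist y E ^ β := by
    rw [Real.div_rpow hd.le (by positivity), div_eq_inv_mul, ← Real.rpow_neg (by positivity)]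
    gcongr <;> linarith
  refine ((h.mono hEc hE (by linarith) hs).tsum_rpow_mul_setLAverage_le hEc hE hα hβ hlam
    (ρ := infDist y E / (2 * lam)) (by positivity) (by field_simp)).trans ?_
  rw [distWeight_eq_ofReal hEc hE hy]
  calc _ ≤ ((3 ^ s * K : ℝ≥0) * ENNReal.ofReal (1 - 2 ^ β)⁻¹ +
          ENNReal.ofReal (1 - 2 ^ (-α))⁻¹ * ENNReal.ofReal (1 - 2 ^ β)⁻¹) *
          ENNReal.ofReal ((2 * lam) ^ s * infDist y E ^ β) := by
        gcongr
        exact le_mul_of_one_le_right' hinv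
    _ = _ := by
        rw [ENNReal.ofReal_mul (by positivity)]
        simp only [ENNReal.ofReal, ENNReal.coe_mul, ENNReal.coe_add]
        ring

theorem AikawaBound.exists_lintegral_distWeight_mul_tsum_le [SecondCountableTopology X]
    [SFinite μ] {D : ℝ≥0} {s α lam : ℝ} (h : AikawaBound μ E s K) (hμ : IsDoublingWith μ D)
    (hEc : IsClosed E) (hE : E.Nonempty) (hα : 0 < α) (hlam : 1 ≤ lam) :
    ∃ K' : ℝ≥0, ∀ β < 0, α - β ≤ s → ∀ H : X → ℝ≥0∞, Measurable H → (∀ x ∈ E, H x = 0) →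
      ∫⁻ x, distWeight E (β - α) x * ∑' m : ℤ, ENNReal.ofReal (((2 : ℝ) ^ m) ^ α) *
          ⨍⁻ y in closedBall x (lam * 2 ^ m), H y ∂μ ∂μ ≤
        K' * ENNReal.ofReal (1 - 2 ^ β)⁻¹ * ∫⁻ y, H y * distWeight E β y ∂μ := by
  obtain ⟨K', hK'⟩ := h.exists_tsum_rpow_mul_setLAverage_le hEc hE hα hlam
  refine ⟨D * K', fun β hβ hs H hH hHE => ?_⟩
  have hw : Measurable (distWeight E (β - α)) := measurable_distWeight hEc _
  calc _ = ∑' m : ℤ, ENNReal.ofReal (((2 : ℝ) ^ m) ^ α) *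
        ∫⁻ x, distWeight E (β - α) x * ⨍⁻ y in closedBall x (lam * 2 ^ m), H y ∂μ ∂μ :=
        lintegral_mul_tsum_const_mul hw (fun m => measurable_setLAverage_closedBall hH _)
          fun m => ENNReal.ofReal_ne_top
    _ ≤ ∑' m : ℤ, ENNReal.ofReal (((2 : ℝ) ^ m) ^ α) *
          (D * ∫⁻ y, H y * ⨍⁻ x in closedBall y (lam * 2 ^ m), distWeight E (β - α) x ∂μ ∂μ) := by
        gcongr with m
        exact hμ.lintegral_mul_setLAverage_le hw hH (by positivity)
    _ = D * ∫⁻ y, H y * ∑' m : ℤ, ENNReal.ofReal (((2 : ℝ) ^ m) ^ α) *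
          ⨍⁻ x in closedBall y (lam * 2 ^ m), distWeight E (β - α) x ∂μ ∂μ := by
        rw [lintegral_mul_tsum_const_mul hH (fun m => measurable_setLAverage_closedBall hw _)
          fun m => ENNReal.ofReal_ne_top, ← ENNReal.tsum_mul_left]
        exact tsum_congr fun m => mul_left_comm _ _ _
    _ ≤ D * ∫⁻ y, K' * ENNReal.ofReal (1 - 2 ^ β)⁻¹ * (H y * distWeight E β y) ∂μ := by
        refine mul_le_mul_right (lintegral_mono fun y => ?_) _
        by_cases hy : y ∈ E
        · simp only [hHE y hy, zero_mul, mul_zero, le_refl]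
        · rw [mul_left_comm]
          exact mul_le_mul_right (hK' β hβ hs y hy) _
    _ = _ := by
        rw [lintegral_const_mul' _ _ (ENNReal.mul_ne_top ENNReal.coe_ne_top ENNReal.ofReal_ne_top),
          ENNReal.coe_mul]
        ring

end DyadicAverages

section HardyOff

variable {X : Type*} [MetricSpace X] {E : Set X}

/-- Test functions for Hardy inequalities off `E`: bounded continuous functions with bounded
support that vanish on `E`. -/
structure IsHardyTestFunction (E : Set X) (v : X → ℝ) : Prop where
  continuous : Continuous v
  bounded : ∃ M, ∀ x, |v x| ≤ M
  isBounded_support : Bornology.IsBounded {x | v x ≠ 0}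
  eq_zero : ∀ x ∈ E, v x = 0

namespace IsHardyTestFunction

variable {v : X → ℝ}

theorem mul_infDist_rpow (hv : IsHardyTestFunction E v) (hE : E.Nonempty) {θ : ℝ} (hθ : 0 < θ) :
    IsHardyTestFunction E fun x => v x * infDist x E ^ θ := by
  obtain ⟨M, hM⟩ := hv.bounded
  obtain ⟨z, hz⟩ := hE
  obtain ⟨R, hR, hsupp⟩ := hv.isBounded_support.subset_closedBall_lt 0 z
  have hM₀ : 0 ≤ M := (abs_nonneg _).trans (hM z)
  refine ⟨hv.continuous.mul ((continuous_infDist_pt E).rpow_const fun _ => Or.inr hθ.le),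
    ⟨M * R ^ θ, fun x => ?_⟩, hv.isBounded_support.subset fun _ hx => left_ne_zero_of_mul hx,
    fun x hx => by rw [hv.eq_zero x hx, zero_mul]⟩
  by_cases hx : v x = 0
  · rw [hx, zero_mul, abs_zero]
    positivity
  · have hdist : infDist x E ≤ R := (infDist_le_dist_of_mem hz).trans (hsupp hx)
    have hd₀ : 0 ≤ infDist x E := infDist_nonneg
    rw [abs_mul, abs_of_nonneg (Real.rpow_nonneg hd₀ θ)]
    gcongr
    exact hM x

theorem abs_rpow (hv : IsHardyTestFunction E v) {a : ℝ} (ha : 0 < a) :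
    IsHardyTestFunction E fun x => |v x| ^ a := by
  obtain ⟨M, hM⟩ := hv.bounded
  have hzero : ∀ x, v x = 0 → |v x| ^ a = 0 := fun x hx => by
    rw [hx, abs_zero, Real.zero_rpow ha.ne']
  refine ⟨hv.continuous.abs.rpow_const fun _ => Or.inr ha.le, ⟨M ^ a, fun x => ?_⟩,
    hv.isBounded_support.subset fun x hx h₀ => hx (hzero x h₀),
    fun x hx => hzero x (hv.eq_zero x hx)⟩
  rw [abs_of_nonneg (by positivity)]
  exact Real.rpow_le_rpow (abs_nonneg _) (hM x) ha.le

variable [MeasurableSpace X] {μ : Measure X}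

theorem integrable [OpensMeasurableSpace X] (hv : IsHardyTestFunction E v)
    (hμ : IsPosFiniteOnBalls μ) : Integrable v μ := by
  rcases isEmpty_or_nonempty X with hX | ⟨⟨z⟩⟩
  · rw [Measure.eq_zero_of_isEmpty μ]
    exact integrable_zero_measure
  obtain ⟨M, hM⟩ := hv.bounded
  obtain ⟨R, hR, hsupp⟩ := hv.isBounded_support.subset_closedBall_lt 0 z
  refine (integrableOn_iff_integrable_of_support_subset hsupp).1 ?_
  exact Measure.integrableOn_of_bounded (hμ.lt_top z hR).ne
    hv.continuous.measurable.aestronglyMeasurable (ae_of_all _ hM)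

end IsHardyTestFunction

variable [MeasurableSpace X] {μ : Measure X}

/-- The `(q, β)`-Hardy inequality off `E` with constant `C`. Unlike in `HardyInequalityFor`, the
test functions are defined on the whole space, and so are their upper gradients. -/
def HardyInequalityOff (μ : Measure X) (E : Set X) (q β : ℝ) (C : ℝ≥0) : Prop :=
  ∀ (v : X → ℝ) (h : X → ℝ≥0∞), IsHardyTestFunction E v → IsUpperGradientOn h v univ →
    ∫⁻ x, ‖v x‖ₑ ^ q * distWeight E (β - q) x ∂μ ≤ C * ∫⁻ x, h x ^ q * distWeight E β x ∂μ

theorem AikawaBound.lintegral_enorm_rpow_mul_distWeight_ne_top [OpensMeasurableSpace X] {s p : ℝ}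
    {K : ℝ≥0} (h : AikawaBound μ E s K) (hμ : IsPosFiniteOnBalls μ) (hE : E.Nonempty) (hp : 0 < p)
    {w : X → ℝ} {M : ℝ} (hM : ∀ x, |w x| ≤ M) (hw : Bornology.IsBounded {x | w x ≠ 0}) :
    ∫⁻ x, ‖w x‖ₑ ^ p * distWeight E (-s) x ∂μ ≠ ∞ := by
  obtain ⟨z, hz⟩ := hE
  obtain ⟨R, hR, hsupp⟩ := hw.subset_closedBall_lt 0 z
  have hMp : ENNReal.ofReal M ^ p ≠ ∞ := ENNReal.rpow_ne_top_of_nonneg hp.le ENNReal.ofReal_ne_top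
  have hball : ∫⁻ x in closedBall z R, distWeight E (-s) x ∂μ ≠ ∞ := by
    refine ne_top_of_le_ne_top (ENNReal.mul_ne_top (ENNReal.mul_ne_top ENNReal.coe_ne_top
      ENNReal.ofReal_ne_top) (hμ.lt_top z hR).ne) (h z R hR ?_)
    rw [infDist_zero_of_mem hz]
    positivity
  refine ne_top_of_le_ne_top (ENNReal.mul_ne_top hMp hball) ?_
  rw [← lintegral_const_mul' _ _ hMp, ← lintegral_indicator measurableSet_closedBall]
  refine lintegral_mono fun x => ?_
  by_cases hx : w x = 0
  · simp [hx, ENNReal.zero_rpow_of_pos hp]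
  · rw [indicator_of_mem (hsupp hx), Real.enorm_eq_ofReal_abs]
    gcongr
    exact hM x

theorem SupportsPoincare.exists_enorm_rpow_mul_distWeight_le [BorelSpace X] {D : ℝ≥0} {q δ : ℝ}
    (hP : SupportsPoincare μ q) (hμ : IsDoublingWith μ D)
    (hX : ¬ Bornology.IsBounded (univ : Set X)) (hEc : IsClosed E) (hE : E.Nonempty)
    (hq : 0 < q) (hδ : 0 < δ) :
    ∃ (K : ℝ≥0) (lam : ℝ), 1 ≤ lam ∧ ∀ (v : X → ℝ) (h : X → ℝ≥0∞), Continuous v →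
      Integrable v μ → IsUpperGradientOn h v univ → ∀ β x,
      ‖v x‖ₑ ^ q * distWeight E (β - q) x ≤
        K * (distWeight E (β - (q + δ)) x * ∑' m : ℤ, ENNReal.ofReal (((2 : ℝ) ^ m) ^ (q + δ)) *
            ⨍⁻ y in closedBall x (lam * 2 ^ m), h y ^ q ∂μ +
          distWeight E (β - (q - δ)) x * ∑' m : ℤ, ENNReal.ofReal (((2 : ℝ) ^ m) ^ (q - δ)) *
            ⨍⁻ y in closedBall x (lam * 2 ^ m), h y ^ q ∂μ) := by
  obtain ⟨K, lam, hlam, hK⟩ := hP.exists_enorm_le_tsum hμ hX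
  set W : ℝ≥0 := (2 * (1 - 2 ^ (-(δ / q)))⁻¹ : ℝ).toNNReal
  refine ⟨K ^ q * W ^ q, lam, hlam, fun v h hv hvi hh β x => ?_⟩
  by_cases hx : x ∈ E
  · simp only [distWeight_of_mem hx, mul_zero, zero_le]
  have hd : 0 < infDist x E := (hEc.notMem_iff_infDist_pos hE).1 hx
  set A : ℤ → ℝ≥0∞ := fun m => ⨍⁻ y in closedBall x (lam * 2 ^ m), h y ^ q ∂μ
  have hterm : ∀ (a : ℝ) (m : ℤ), ENNReal.ofReal ((2 ^ m / infDist x E) ^ a) *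
      (ENNReal.ofReal (2 ^ m) * A m ^ (1 / q)) ^ q =
        distWeight E (-a) x * (ENNReal.ofReal (((2 : ℝ) ^ m) ^ (q + a)) * A m) := by
    intro a m
    have hm : (0 : ℝ) < 2 ^ m := by positivity
    rw [distWeight_eq_ofReal hEc hE hx, ENNReal.mul_rpow_of_nonneg _ _ hq.le, ← ENNReal.rpow_mul,
      one_div_mul_cancel hq.ne', ENNReal.rpow_one, ENNReal.ofReal_rpow_of_pos hm,
      Real.div_rpow hm.le hd.le, div_eq_mul_inv, ← Real.rpow_neg hd.le, Real.rpow_add hm,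
      ENNReal.ofReal_mul (by positivity), ENNReal.ofReal_mul (by positivity)]
    ring
  have hsum := tsum_rpow_le_tsum_dyadic hq (div_pos hδ hq) hd
    fun m => ENNReal.ofReal (2 ^ m) * A m ^ (1 / q)
  simp only [div_mul_cancel₀ δ hq.ne', hterm, ENNReal.tsum_mul_left, neg_neg,
    ← sub_eq_add_neg] at hsum
  have hweight : ∀ a, distWeight E (β - (q + a)) x = distWeight E (-a) x * distWeight E (β - q) x :=
    fun a => by rw [distWeight_mul hEc hE, neg_add_eq_sub, sub_sub]
  calc ‖v x‖ₑ ^ q * distWeight E (β - q) x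
      ≤ (K * ∑' m : ℤ, ENNReal.ofReal (2 ^ m) * A m ^ (1 / q)) ^ q * distWeight E (β - q) x := by
        gcongr
        exact hK v h hv hvi hh x
    _ ≤ K ^ q * (W ^ q * (distWeight E (-δ) x * _ + distWeight E δ x * _)) *
          distWeight E (β - q) x := by
        rw [ENNReal.mul_rpow_of_nonneg _ _ hq.le]
        exact mul_le_mul_left (mul_le_mul_right hsum _) _
    _ = _ := by
        rw [hweight, sub_eq_add_neg q δ, hweight, neg_neg, ENNReal.coe_mul,
          ENNReal.coe_rpow_of_nonneg _ hq.le, ENNReal.coe_rpow_of_nonneg _ hq.le]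
        ring

theorem AikawaBound.exists_hardyInequalityOff_of_neg [BorelSpace X] {D K : ℝ≥0} {q δ s : ℝ}
    (h : AikawaBound μ E s K) (hP : SupportsPoincare μ q) (hμ : IsDoublingWith μ D)
    (hX : ¬ Bornology.IsBounded (univ : Set X)) (hEc : IsClosed E) (hE : E.Nonempty)
    (hδ : 0 < δ) (hδq : δ < q) :
    ∃ C : ℝ≥0, ∀ β < 0, q + δ - β ≤ s →
      HardyInequalityOff μ E q β (C * (1 - 2 ^ β : ℝ)⁻¹.toNNReal) := by
  have := hμ.sigmaFinite
  have := hμ.secondCountableTopology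
  have hq : 0 < q := hδ.trans hδq
  obtain ⟨K₀, lam, hlam, hpoint⟩ := hP.exists_enorm_rpow_mul_distWeight_le hμ hX hEc hE hq hδ
  obtain ⟨K₁, hK₁⟩ :=
    h.exists_lintegral_distWeight_mul_tsum_le hμ hEc hE (add_pos hq hδ) hlam
  obtain ⟨K₂, hK₂⟩ :=
    h.exists_lintegral_distWeight_mul_tsum_le hμ hEc hE (sub_pos.2 hδq) hlam
  refine ⟨K₀ * (K₁ + K₂), fun β hβ hs v g hv hg => ?_⟩
  set H : X → ℝ≥0∞ := fun x => ({y | v y ≠ 0}.indicator g x) ^ q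
  have hgv : IsUpperGradientOn ({y | v y ≠ 0}.indicator g) v univ :=
    hg.indicator_ne_zero hv.continuous
  have hH : Measurable H := hgv.1.pow_const q
  have hHE : ∀ x ∈ E, H x = 0 := fun x hx => by
    simp [H, hv.eq_zero x hx, hq]
  have hHg : ∫⁻ x, H x * distWeight E β x ∂μ ≤ ∫⁻ x, g x ^ q * distWeight E β x ∂μ := by
    refine lintegral_mono fun x => mul_le_mul_left (ENNReal.rpow_le_rpow ?_ hq.le) _
    exact indicator_le_self _ _ x
  have hmeas : Measurable fun x => distWeight E (β - (q + δ)) x * ∑' m : ℤ,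
      ENNReal.ofReal (((2 : ℝ) ^ m) ^ (q + δ)) * ⨍⁻ y in closedBall x (lam * 2 ^ m), H y ∂μ :=
    (measurable_distWeight hEc _).mul (Measurable.tsum fun m =>
      (measurable_setLAverage_closedBall hH _).const_mul _)
  calc ∫⁻ x, ‖v x‖ₑ ^ q * distWeight E (β - q) x ∂μ
      ≤ _ := lintegral_mono
        (hpoint v _ hv.continuous (hv.integrable hμ.toIsPosFiniteOnBalls) hgv β)
    _ ≤ K₀ * (K₁ * ENNReal.ofReal (1 - 2 ^ β)⁻¹ * ∫⁻ x, H x * distWeight E β x ∂μ +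
          K₂ * ENNReal.ofReal (1 - 2 ^ β)⁻¹ * ∫⁻ x, H x * distWeight E β x ∂μ) := by
        rw [lintegral_const_mul' _ _ ENNReal.coe_ne_top, lintegral_add_left hmeas]
        gcongr
        · exact hK₁ β hβ hs H hH hHE
        · exact hK₂ β hβ (by linarith) H hH hHE
    _ ≤ _ := by
        rw [← add_mul, ← add_mul, ← mul_assoc, ← mul_assoc, ENNReal.coe_mul, ENNReal.coe_mul,
          ENNReal.coe_add]
        exact mul_le_mul_right hHg _

end HardyOff

section NonnegativeExponents

open Filter Topology

theorem exists_mul_inv_one_sub_two_rpow_mul_rpow_le {c q η : ℝ} (hq : 1 < q) (hc : 0 ≤ c)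
    (hη : 0 < η) : ∃ ε, 0 < ε ∧ ε ≤ η ∧ c * (1 - 2 ^ (-ε))⁻¹ * (ε / q) ^ q ≤ 2⁻¹ := by
  have hlim : Tendsto (fun ε : ℝ => c * 2 * ε ^ (q - 1)) (𝓝[>] 0) (𝓝 0) := by
    have hcont : Tendsto (fun ε : ℝ => ε ^ (q - 1)) (𝓝[>] 0) (𝓝 0) := by
      simpa [Real.zero_rpow (sub_pos.2 hq).ne'] using
        ((Real.continuous_rpow_const (sub_pos.2 hq).le).tendsto 0).mono_left nhdsWithin_le_nhds
    simpa using hcont.const_mul (c * 2)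
  have hnear : ∀ᶠ ε : ℝ in 𝓝[>] 0, ε ∈ Ioc 0 (min η 1) :=
    Ioc_mem_nhdsGT (lt_min hη one_pos)
  obtain ⟨ε, ⟨hε₀, hεle⟩, hε⟩ :=
    (hnear.and (hlim.eventually_le_const (by norm_num : (0 : ℝ) < 2⁻¹))).exists
  obtain ⟨hεη, hε₁⟩ := le_min_iff.1 hεle
  have hbernoulli : (2 : ℝ) ^ (-ε) ≤ 1 - ε / 2 := by
    have h := rpow_one_add_le_one_add_mul_self (s := -(1 / 2)) (by norm_num) hε₀.le hε₁
    rw [Real.rpow_neg (by norm_num), ← Real.inv_rpow (by norm_num)]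
    norm_num at h ⊢
    linarith
  refine ⟨ε, hε₀, hεη, le_trans ?_ hε⟩
  calc c * (1 - 2 ^ (-ε))⁻¹ * (ε / q) ^ q ≤ c * (ε / 2)⁻¹ * ε ^ q := by
        gcongr
        · linarith
        · exact div_le_self hε₀.le hq.le
    _ = c * 2 * ε ^ (q - 1) := by
        rw [Real.rpow_sub_one hε₀.ne']
        field_simp

theorem le_two_mul_of_le_add_mul {a b c : ℝ≥0∞} (ha : a ≠ ∞) (hc : c ≤ 2⁻¹)
    (h : a ≤ b + c * a) : a ≤ 2 * b := by
  have hhalf : 2⁻¹ * a + 2⁻¹ * a ≤ b + 2⁻¹ * a := by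
    rw [← add_mul, ENNReal.inv_two_add_inv_two, one_mul]
    exact h.trans (by gcongr)
  have hle := (ENNReal.add_le_add_iff_right (ENNReal.mul_ne_top (by simp) ha)).1 hhalf
  calc a = 2 * (2⁻¹ * a) := by
        rw [← mul_assoc, ENNReal.mul_inv_cancel two_ne_zero ENNReal.ofNat_ne_top, one_mul]
    _ ≤ 2 * b := by gcongr

theorem le_rpow_inv_of_le_rpow_mul {a b : ℝ≥0∞} {r s : ℝ} (ha : a ≠ ∞) (hr : 0 < r)
    (hs : 0 ≤ s) (hrs : r + s = 1) (h : a ≤ a ^ s * b) : a ≤ b ^ r⁻¹ := by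
  rcases eq_or_ne a 0 with rfl | ha₀
  · exact zero_le
  rw [ENNReal.le_rpow_inv_iff hr]
  refine (ENNReal.mul_le_mul_iff_right (a := a ^ s) (ENNReal.rpow_pos
    (pos_iff_ne_zero.2 ha₀) ha).ne' (ENNReal.rpow_ne_top_of_nonneg hs ha)).1 ?_
  rwa [← ENNReal.rpow_add _ _ ha₀ ha, add_comm, hrs, ENNReal.rpow_one]

variable {X : Type*} [MetricSpace X] [MeasurableSpace X] [BorelSpace X] {μ : Measure X}
  {E : Set X}

theorem HardyInequalityOff.lintegral_le_of_shift {q β θ : ℝ} {C : ℝ≥0}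
    (hH : HardyInequalityOff μ E q β C) (hEc : IsClosed E) (hE : E.Nonempty) (hq : 1 ≤ q)
    (hθ : 0 < θ) {v : X → ℝ} {h : X → ℝ≥0∞} (hv : IsHardyTestFunction E v)
    (hh : IsUpperGradientOn h v univ) :
    ∫⁻ x, ‖v x‖ₑ ^ q * distWeight E (β + θ * q - q) x ∂μ ≤
      C * 2 ^ (q - 1) * (∫⁻ x, h x ^ q * distWeight E (β + θ * q) x ∂μ +
        ENNReal.ofReal θ ^ q * ∫⁻ x, ‖v x‖ₑ ^ q * distWeight E (β + θ * q - q) x ∂μ) := by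
  have hq₀ : 0 < q := by linarith
  have hd : ∀ x, 0 ≤ infDist x E := fun _ => infDist_nonneg
  have hweight : ∀ a γ x, ENNReal.ofReal (infDist x E ^ a) ^ q * distWeight E γ x =
      distWeight E (a * q + γ) x := fun a γ x => by
    rw [ENNReal.ofReal_rpow_of_nonneg (Real.rpow_nonneg (hd x) a) hq₀.le, ← Real.rpow_mul (hd x),
      ofReal_infDist_rpow_mul_distWeight hEc hE]
  have hleft : ∀ x, ‖v x * infDist x E ^ θ‖ₑ ^ q * distWeight E (β - q) x =
      ‖v x‖ₑ ^ q * distWeight E (β + θ * q - q) x := fun x => by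
    rw [enorm_mul, ENNReal.mul_rpow_of_nonneg _ _ hq₀.le,
      Real.enorm_of_nonneg (Real.rpow_nonneg (hd x) θ), mul_assoc, hweight]
    congr 2
    ring
  have hright : ∀ x, (ENNReal.ofReal (infDist x E ^ θ) * h x +
      ‖v x‖ₑ * ENNReal.ofReal (θ * infDist x E ^ (θ - 1))) ^ q * distWeight E β x ≤
      2 ^ (q - 1) * (h x ^ q * distWeight E (β + θ * q) x +
        ENNReal.ofReal θ ^ q * (‖v x‖ₑ ^ q * distWeight E (β + θ * q - q) x)) := fun x => by
    refine (mul_le_mul_left (ENNReal.rpow_add_le_mul_rpow_add_rpow _ _ hq) _).trans_eq ?_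
    rw [show β + θ * q - q = (θ - 1) * q + β by ring, add_comm β, ← hweight, ← hweight,
      ENNReal.ofReal_mul hθ.le]
    simp only [ENNReal.mul_rpow_of_nonneg _ _ hq₀.le]
    ring
  have hm : Measurable fun x => ‖v x‖ₑ ^ q * distWeight E (β + θ * q - q) x :=
    (hv.continuous.measurable.enorm.pow_const q).mul (measurable_distWeight hEc _)
  calc _ ≤ C * ∫⁻ x, _ ∂μ := by
        simpa only [hleft] using hH _ _ (hv.mul_infDist_rpow hE hθ)
          (hh.mul_rpow hv.continuous (lipschitz_infDist_pt E) hd hθ)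
    _ ≤ C * ∫⁻ x, _ ∂μ := mul_le_mul_right (lintegral_mono hright) _
    _ = _ := by
        rw [lintegral_const_mul' _ _ (by simp), lintegral_add_right _ (hm.const_mul _),
          lintegral_const_mul _ hm, mul_assoc]

theorem AikawaBound.exists_hardyInequalityOff_zero {D K : ℝ≥0} {q s : ℝ}
    (h : AikawaBound μ E s K) (hP : SupportsPoincare μ q) (hμ : IsDoublingWith μ D)
    (hX : ¬ Bornology.IsBounded (univ : Set X)) (hEc : IsClosed E) (hE : E.Nonempty)
    (hq : 1 < q) (hqs : q < s) : ∃ C : ℝ≥0, HardyInequalityOff μ E q 0 C := by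
  have hq₀ : 0 < q := by linarith
  obtain ⟨δ, hδ, hδq, hδs⟩ : ∃ δ, 0 < δ ∧ δ < q ∧ q + 2 * δ ≤ s :=
    ⟨min (q / 2) ((s - q) / 2), lt_min (by linarith) (by linarith),
      (min_le_left _ _).trans_lt (by linarith), by linarith [min_le_right (q / 2) ((s - q) / 2)]⟩
  obtain ⟨C, hC⟩ := h.exists_hardyInequalityOff_of_neg hP hμ hX hEc hE hδ hδq
  -- `(1 - 2 ^ (-ε))⁻¹` is of order `1 / ε`, so the shift by `ε / q` costs a factor `ε ^ (q - 1)`.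
  obtain ⟨ε, hε, hεδ, hsmall⟩ := exists_mul_inv_one_sub_two_rpow_mul_rpow_le hq
    (c := C * 2 ^ (q - 1)) (by positivity) hδ
  have hinv : 0 ≤ (1 - (2 : ℝ) ^ (-ε))⁻¹ := inv_nonneg.2 <| sub_nonneg.2 <|
    Real.rpow_le_one_of_one_le_of_nonpos one_le_two (by linarith)
  set Cε : ℝ≥0 := C * (1 - 2 ^ (-ε) : ℝ)⁻¹.toNNReal
  have habsorb : Cε * 2 ^ (q - 1) * ENNReal.ofReal (ε / q) ^ q ≤ 2⁻¹ := by
    calc _ = ENNReal.ofReal (C * 2 ^ (q - 1) * (1 - 2 ^ (-ε))⁻¹ * (ε / q) ^ q) := by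
          rw [ENNReal.ofReal_mul (by positivity), ENNReal.ofReal_mul (by positivity),
            ENNReal.ofReal_mul C.coe_nonneg, ENNReal.ofReal_coe_nnreal,
            ← ENNReal.ofReal_rpow_of_pos two_pos, ← ENNReal.ofReal_rpow_of_pos (div_pos hε hq₀),
            ENNReal.ofReal_ofNat, mul_right_comm (C : ℝ≥0∞), ENNReal.coe_mul]
          rfl
      _ ≤ ENNReal.ofReal 2⁻¹ := ENNReal.ofReal_le_ofReal hsmall
      _ = 2⁻¹ := by rw [ENNReal.ofReal_inv_of_pos two_pos, ENNReal.ofReal_ofNat]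
  refine ⟨2 * (Cε * 2 ^ (q - 1)), fun v g hv hg => ?_⟩
  have hfin : ∫⁻ x, ‖v x‖ₑ ^ q * distWeight E (0 - q) x ∂μ ≠ ∞ := by
    obtain ⟨M, hM⟩ := hv.bounded
    rw [zero_sub]
    exact (h.mono hEc hE hq₀.le hqs.le).lintegral_enorm_rpow_mul_distWeight_ne_top
      hμ.toIsPosFiniteOnBalls hE hq₀ hM hv.isBounded_support
  have hshift := (hC (-ε) (by linarith) (by linarith)).lintegral_le_of_shift hEc hE hq.le
    (div_pos hε hq₀) hv hg
  rw [div_mul_cancel₀ ε hq₀.ne', neg_add_cancel, mul_add, ← mul_assoc] at hshift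
  refine (le_two_mul_of_le_add_mul hfin habsorb hshift).trans_eq ?_
  rw [ENNReal.coe_mul 2, ENNReal.coe_mul Cε, ENNReal.coe_rpow_of_nonneg _ (by linarith),
    ENNReal.coe_ofNat, mul_assoc 2]

theorem lintegral_enorm_rpow_mul_rpow_le (hEc : IsClosed E) (hE : E.Nonempty) {p β : ℝ}
    (hβ : 0 < β) (hβp : β < p) {v : X → ℝ} {h : X → ℝ≥0∞} (hv : Measurable v)
    (hh : Measurable h) :
    ∫⁻ x, ‖v x‖ₑ ^ β * h x ^ (p - β) * distWeight E 0 x ∂μ ≤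
      (∫⁻ x, ‖v x‖ₑ ^ p * distWeight E (β - p) x ∂μ) ^ (β / p) *
        (∫⁻ x, h x ^ p * distWeight E β x ∂μ) ^ ((p - β) / p) := by
  have hp : 0 < p := hβ.trans hβp
  have hq : 0 < p - β := sub_pos.2 hβp
  have hconj : (p / β).HolderConjugate (p / (p - β)) := by
    rw [Real.holderConjugate_iff, inv_div, inv_div, ← add_div, add_sub_cancel, div_self hp.ne']
    exact ⟨(one_lt_div hβ).2 hβp, rfl⟩
  set γ : ℝ := (p - β) * β / p
  set F : X → ℝ≥0∞ := fun x => ‖v x‖ₑ ^ β * distWeight E (-γ) x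
  set G : X → ℝ≥0∞ := fun x => h x ^ (p - β) * distWeight E γ x
  have hF : ∀ x, F x ^ (p / β) = ‖v x‖ₑ ^ p * distWeight E (β - p) x := fun x => by
    rw [ENNReal.mul_rpow_of_nonneg _ _ (by positivity), ← ENNReal.rpow_mul,
      distWeight_rpow (by positivity), mul_div_cancel₀ _ hβ.ne']
    congr 2
    simp only [γ]
    field_simp
    ring
  have hG : ∀ x, G x ^ (p / (p - β)) = h x ^ p * distWeight E β x := fun x => by
    rw [ENNReal.mul_rpow_of_nonneg _ _ (by positivity), ← ENNReal.rpow_mul,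
      distWeight_rpow (by positivity), mul_div_cancel₀ _ hq.ne']
    congr 2
    simp only [γ]
    field_simp
  have hFG : ∀ x, ‖v x‖ₑ ^ β * h x ^ (p - β) * distWeight E 0 x = (F * G) x := fun x => by
    rw [← neg_add_cancel γ, ← distWeight_mul hEc hE]
    exact mul_mul_mul_comm _ _ _ _
  have hFm : Measurable F := (hv.enorm.pow_const β).mul (measurable_distWeight hEc (-γ))
  have hGm : Measurable G := (hh.pow_const (p - β)).mul (measurable_distWeight hEc γ)
  simpa only [hFG, hF, hG, one_div_div] using
    ENNReal.lintegral_mul_le_Lp_mul_Lq μ hconj hFm.aemeasurable hGm.aemeasurable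

theorem HardyInequalityOff.exists_of_zero {C K : ℝ≥0} {p β : ℝ}
    (hH : HardyInequalityOff μ E (p - β) 0 C) (h : AikawaBound μ E (p - β) K)
    (hμ : IsPosFiniteOnBalls μ) (hEc : IsClosed E) (hE : E.Nonempty) (hβ : 0 < β) (hβp : β < p) :
    ∃ C' : ℝ≥0, HardyInequalityOff μ E p β C' := by
  have hp : 0 < p := hβ.trans hβp
  have hq : 0 < p - β := sub_pos.2 hβp
  set a : ℝ := p / (p - β)
  have ha : 0 < a := div_pos hp hq
  have ha₁ : 0 ≤ a - 1 := sub_nonneg.2 ((one_le_div hq).2 (by linarith))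
  have haq : a * (p - β) = p := div_mul_cancel₀ _ hq.ne'
  set C₁ : ℝ≥0 := C * a.toNNReal ^ (p - β)
  refine ⟨C₁ ^ a, fun v g hv hg => ?_⟩
  set A := ∫⁻ x, ‖v x‖ₑ ^ p * distWeight E (β - p) x ∂μ
  set G := ∫⁻ x, g x ^ p * distWeight E β x ∂μ
  have hfin : A ≠ ∞ := by
    obtain ⟨M, hM⟩ := hv.bounded
    simp only [A, ← neg_sub p β]
    exact h.lintegral_enorm_rpow_mul_distWeight_ne_top hμ hE hp hM hv.isBounded_support
  have hleft : ∀ x, ‖|v x| ^ a‖ₑ ^ (p - β) * distWeight E (0 - (p - β)) x =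
      ‖v x‖ₑ ^ p * distWeight E (β - p) x := fun x => by
    rw [Real.enorm_rpow_of_nonneg (abs_nonneg _) ha.le, Real.enorm_abs, ← ENNReal.rpow_mul, haq,
      zero_sub, neg_sub]
  have hright : ∀ x, (ENNReal.ofReal (a * |v x| ^ (a - 1)) * g x) ^ (p - β) *
      distWeight E 0 x = ENNReal.ofReal a ^ (p - β) *
        (‖v x‖ₑ ^ β * g x ^ (p - β) * distWeight E 0 x) := fun x => by
    have hexp : (a - 1) * (p - β) = β := by linarith
    rw [ENNReal.ofReal_mul ha.le, ← ENNReal.ofReal_rpow_of_nonneg (abs_nonneg _) ha₁,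
      ← Real.enorm_eq_ofReal_abs, ENNReal.mul_rpow_of_nonneg _ _ hq.le,
      ENNReal.mul_rpow_of_nonneg _ _ hq.le, ← ENNReal.rpow_mul, hexp]
    ring
  have hself : A ≤ A ^ (β / p) * (C₁ * G ^ ((p - β) / p)) :=
    calc A ≤ C * (ENNReal.ofReal a ^ (p - β) *
          ∫⁻ x, ‖v x‖ₑ ^ β * g x ^ (p - β) * distWeight E 0 x ∂μ) := by
          rw [← lintegral_const_mul' _ _ (by simp [ha.not_ge])]
          simpa only [hleft, hright] using hH _ _ (hv.abs_rpow ha) (hg.abs_rpow hv.continuous ha)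
      _ ≤ C * (ENNReal.ofReal a ^ (p - β) * (A ^ (β / p) * G ^ ((p - β) / p))) := by
          gcongr
          exact lintegral_enorm_rpow_mul_rpow_le hEc hE hβ hβp hv.continuous.measurable hg.1
      _ = _ := by
          rw [ENNReal.coe_mul, ENNReal.coe_rpow_of_nonneg _ hq.le, ENNReal.ofReal]
          ring
  refine (le_rpow_inv_of_le_rpow_mul hfin (div_pos hq hp) (by positivity)
    (by field_simp; ring) hself).trans_eq ?_
  rw [ENNReal.mul_rpow_of_nonneg _ _ (by positivity), inv_div, ← ENNReal.rpow_mul,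
    div_mul_div_cancel₀ hp.ne', div_self hq.ne', ENNReal.rpow_one,
    ENNReal.coe_rpow_of_nonneg _ ha.le]

end NonnegativeExponents

section RemovingTheBoundaryCondition

open Filter Topology

variable {X : Type*} [MetricSpace X] {E : Set X} {w : X → ℝ} {M : ℝ} {ε : ℝ≥0}

theorem isHardyTestFunction_mul_cutoff (hEc : IsClosed E) (hw : ContinuousOn w Eᶜ)
    (hM : ∀ x, |w x| ≤ M) (hsupp : Bornology.IsBounded {x | w x ≠ 0}) (hε : 0 < ε) :
    IsHardyTestFunction E fun x => w x * cutoff ε (infDist x E) := by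
  have hd : Continuous fun x => infDist x E := continuous_infDist_pt E
  refine ⟨continuous_iff_continuousAt.2 fun x => ?_, ⟨M, fun x => ?_⟩,
    hsupp.subset fun x hx => left_ne_zero_of_mul hx, fun x hx => ?_⟩
  · by_cases hx : x ∈ E
    · have hnear : ∀ᶠ y in 𝓝 x, infDist y E < ε := hd.continuousAt.eventually_lt_const <| by
        simpa only [infDist_zero_of_mem hx] using NNReal.coe_pos.2 hε
      refine continuousAt_const.congr (f := fun _ => (0 : ℝ)) ?_
      filter_upwards [hnear] with y hy
      rw [cutoff_eq_zero hε hy.le, mul_zero]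
    · exact (hw.continuousAt (hEc.isOpen_compl.mem_nhds hx)).mul
        ((lipschitzWith_cutoff ε).continuous.comp hd).continuousAt
  · rw [abs_mul, abs_of_nonneg (cutoff_nonneg ε _)]
    exact (mul_le_of_le_one_right (abs_nonneg _) (cutoff_le_one ε _)).trans (hM x)
  · rw [infDist_zero_of_mem hx, cutoff_eq_zero hε (NNReal.coe_nonneg ε), mul_zero]

theorem cutoffSlope_infDist_le (hEc : IsClosed E) (hE : E.Nonempty) (hε : 0 < ε) {x : X}
    (hx : x ∉ E) : cutoffSlope ε (infDist x E) ≤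
      (thickening (2 * ε) E).indicator (fun x => 2 * distWeight E (-1) x) x := by
  by_cases hxε : infDist x E < 2 * ε
  · have hd : 0 < infDist x E := (hEc.notMem_iff_infDist_pos hE).1 hx
    have hinv : (ε : ℝ)⁻¹ ≤ 2 * (infDist x E)⁻¹ := by
      rw [← div_eq_mul_inv, inv_le_comm₀ (by exact_mod_cast hε) (by positivity), inv_div]
      linarith
    rw [indicator_of_mem ((mem_thickening_iff_infDist_lt hE).2 hxε),
      distWeight_eq_ofReal hEc hE hx, Real.rpow_neg_one, ← ENNReal.ofReal_ofNat,
      ← ENNReal.ofReal_mul zero_le_two]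
    refine (cutoffSlope_le ε _).trans ?_
    rw [← ENNReal.ofReal_coe_nnreal, NNReal.coe_inv]
    exact ENNReal.ofReal_le_ofReal hinv
  · rw [cutoffSlope, indicator_of_notMem (by simpa using hxε)]
    exact zero_le

theorem cutoffSlope_rpow_mul_distWeight_le (hEc : IsClosed E) (hE : E.Nonempty) (hε : 0 < ε)
    {p : ℝ} (hp : 0 < p) (β : ℝ) (x : X) :
    cutoffSlope ε (infDist x E) ^ p * distWeight E β x ≤
      2 ^ p * (thickening (2 * ε) E).indicator (distWeight E (β - p)) x := by
  by_cases hx : x ∈ E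
  · rw [distWeight_of_mem hx, mul_zero]
    exact zero_le
  have hslope := cutoffSlope_infDist_le hEc hE hε hx
  by_cases hxε : x ∈ thickening (2 * ε) E
  · rw [indicator_of_mem hxε] at hslope ⊢
    calc _ ≤ (2 * distWeight E (-1) x) ^ p * distWeight E β x := by gcongr
      _ = _ := by
        rw [ENNReal.mul_rpow_of_nonneg _ _ hp.le, distWeight_rpow hp, mul_assoc,
          distWeight_mul hEc hE, neg_one_mul, neg_add_eq_sub]
  · rw [indicator_of_notMem hxε, nonpos_iff_eq_zero] at hslope
    rw [hslope, ENNReal.zero_rpow_of_pos hp, zero_mul]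
    exact zero_le

theorem add_mul_cutoffSlope_rpow_mul_distWeight_le (hEc : IsClosed E) (hE : E.Nonempty)
    (hε : 0 < ε) {p : ℝ} (hp : 1 ≤ p) (β : ℝ) (a b : X → ℝ≥0∞) (x : X) :
    (a x + b x * cutoffSlope ε (infDist x E)) ^ p * distWeight E β x ≤
      2 ^ (p - 1) * (a x ^ p * distWeight E β x + 2 ^ p *
        (thickening (2 * ε) E).indicator (fun x => b x ^ p * distWeight E (β - p) x) x) := by
  have hp₀ : 0 < p := by linarith
  calc _ ≤ 2 ^ (p - 1) * (a x ^ p + (b x * cutoffSlope ε (infDist x E)) ^ p) *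
          distWeight E β x := by
        gcongr
        exact ENNReal.rpow_add_le_mul_rpow_add_rpow _ _ hp
    _ = 2 ^ (p - 1) * (a x ^ p * distWeight E β x +
          b x ^ p * (cutoffSlope ε (infDist x E) ^ p * distWeight E β x)) := by
        rw [ENNReal.mul_rpow_of_nonneg _ _ hp₀.le]
        ring
    _ ≤ 2 ^ (p - 1) * (a x ^ p * distWeight E β x + b x ^ p *
          (2 ^ p * (thickening (2 * ε) E).indicator (distWeight E (β - p)) x)) := by
        gcongr 2 ^ (p - 1) * (_ + _ * ?_)
        exact cutoffSlope_rpow_mul_distWeight_le hEc hE hε hp₀ β x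
    _ = _ := by rw [indicator_mul_right, mul_left_comm]

theorem exists_abs_indicator_le_of_mem_lipB {Ω : Set X} {u : X → ℝ} (hu : u ∈ LipB Ω) :
    ∃ M, ∀ x, |Ω.indicator u x| ≤ M := by
  obtain ⟨⟨L, hL⟩, hb⟩ := hu
  have hsupp : ∀ {x}, Ω.indicator u x ≠ 0 → x ∈ {x ∈ Ω | u x ≠ 0} := indicator_apply_ne_zero.1
  rcases {x ∈ Ω | u x ≠ 0}.eq_empty_or_nonempty with hzero | ⟨z, hz⟩
  · exact ⟨0, fun x => abs_nonpos_iff.2 <| by_contra fun hne =>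
      eq_empty_iff_forall_notMem.1 hzero x (hsupp hne)⟩
  refine ⟨|u z| + L * diam {x ∈ Ω | u x ≠ 0}, fun x => ?_⟩
  by_cases hne : Ω.indicator u x = 0
  · rw [hne, abs_zero]
    positivity
  have hx := hsupp hne
  rw [indicator_of_mem hx.1]
  calc |u x| ≤ |u z| + |u x - u z| := by linarith [abs_sub_abs_le_abs_sub (u x) (u z)]
    _ ≤ |u z| + L * diam {x ∈ Ω | u x ≠ 0} := by
        gcongr
        refine (hL.dist_le_mul x hx.1 z hz.1).trans ?_
        gcongr
        exact dist_le_diam_of_mem hb hx hz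

variable [MeasurableSpace X] {μ : Measure X}

theorem hardyInequalityFor_of_compl_eq_empty {Ω : Set X} (hΩ : Ωᶜ = ∅) {p β : ℝ}
    (hβp : β < p) (F : Set (X → ℝ)) : HardyInequalityFor μ Ω p β F := by
  refine ⟨1, one_pos, fun u _ g _ => ?_⟩
  simp only [hΩ, infEDist_empty, ENNReal.top_rpow_of_neg (sub_neg.2 hβp), mul_zero, lintegral_zero]
  exact zero_le

variable [BorelSpace X]

theorem tendsto_setLIntegral_thickening_zero (hEc : IsClosed E) {f : X → ℝ≥0∞}
    (hf : ∫⁻ x, f x ∂μ ≠ ∞) (hfE : ∀ x ∈ E, f x = 0) :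
    Tendsto (fun δ => ∫⁻ x in thickening δ E, f x ∂μ) (𝓝[>] 0) (𝓝 0) := by
  have hfin : ∃ δ > 0, μ.withDensity f (thickening δ E) ≠ ∞ := by
    refine ⟨1, one_pos, ?_⟩
    rw [withDensity_apply _ isOpen_thickening.measurableSet]
    exact ne_top_of_le_ne_top hf (setLIntegral_le_lintegral _ _)
  have hzero : μ.withDensity f E = 0 := by
    rw [withDensity_apply _ hEc.measurableSet, setLIntegral_congr_fun hEc.measurableSet hfE,
      lintegral_zero]
  simpa only [hzero, withDensity_apply _ isOpen_thickening.measurableSet] using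
    tendsto_measure_thickening_of_isClosed hfin hEc

namespace HardyInequalityOff

variable {p β : ℝ} {C : ℝ≥0} {g : X → ℝ≥0∞}

theorem lintegral_le_add_setLIntegral_thickening (hH : HardyInequalityOff μ E p β C)
    (hEc : IsClosed E) (hE : E.Nonempty) (hp : 1 ≤ p) (hwm : Measurable w)
    (hwc : ContinuousOn w Eᶜ) (hM : ∀ x, |w x| ≤ M) (hsupp : Bornology.IsBounded {x | w x ≠ 0})
    (hg : IsUpperGradientOn g w Eᶜ) (hε : 0 < ε) :
    ∫⁻ x, ‖w x‖ₑ ^ p * distWeight E (β - p) x ∂μ ≤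
      (∫⁻ x in thickening (2 * ε) E, ‖w x‖ₑ ^ p * distWeight E (β - p) x ∂μ) +
        C * (2 ^ (p - 1) * ((∫⁻ x, g x ^ p * distWeight E β x ∂μ) +
          2 ^ p * ∫⁻ x in thickening (2 * ε) E, ‖w x‖ₑ ^ p * distWeight E (β - p) x ∂μ)) := by
  set F : X → ℝ≥0∞ := fun x => ‖w x‖ₑ ^ p * distWeight E (β - p) x
  set d : X → ℝ := fun x => infDist x E
  have hF : Measurable F := (hwm.enorm.pow_const p).mul (measurable_distWeight hEc (β - p))
  have hT : MeasurableSet (thickening (2 * ε : ℝ) E) := isOpen_thickening.measurableSet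
  have hG : Measurable fun x => g x ^ p * distWeight E β x :=
    (hg.1.pow_const p).mul (measurable_distWeight hEc β)
  have hv := isHardyTestFunction_mul_cutoff hEc hwc hM hsupp hε
  have hhardy := hH _ _ hv (hg.mul_cutoff hwc hwm (lipschitz_infDist_pt E)
    (fun x hx => (hEc.notMem_iff_infDist_pos hE).2 hx) hε hv.continuous)
  have hsplit : ∀ x, F x ≤ (thickening (2 * ε) E).indicator F x +
      ‖w x * cutoff ε (d x)‖ₑ ^ p * distWeight E (β - p) x := fun x => by
    by_cases hx : x ∈ thickening (2 * ε : ℝ) E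
    · rw [indicator_of_mem hx]
      exact le_self_add
    · rw [mem_thickening_iff_infDist_lt hE, not_lt] at hx
      rw [cutoff_eq_one hε hx, mul_one]
      exact le_add_self
  calc ∫⁻ x, F x ∂μ ≤ (∫⁻ x in thickening (2 * ε) E, F x ∂μ) +
        ∫⁻ x, ‖w x * cutoff ε (d x)‖ₑ ^ p * distWeight E (β - p) x ∂μ := by
        rw [← lintegral_indicator hT, ← lintegral_add_left (hF.indicator hT)]
        exact lintegral_mono hsplit
    _ ≤ _ := by
        grw [hhardy, lintegral_mono fun x =>
          add_mul_cutoffSlope_rpow_mul_distWeight_le hEc hE hε hp β g (fun x => ‖w x‖ₑ) x]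
        rw [lintegral_const_mul' _ _ (by finiteness), lintegral_add_left hG,
          lintegral_const_mul' _ _ (by finiteness), ← lintegral_indicator hT]

theorem lintegral_le_of_continuousOn (hH : HardyInequalityOff μ E p β C)
    (hEc : IsClosed E) (hE : E.Nonempty) (hp : 1 ≤ p) (hwm : Measurable w)
    (hwc : ContinuousOn w Eᶜ) (hM : ∀ x, |w x| ≤ M) (hsupp : Bornology.IsBounded {x | w x ≠ 0})
    (hfin : ∫⁻ x, ‖w x‖ₑ ^ p * distWeight E (β - p) x ∂μ ≠ ∞) (hg : IsUpperGradientOn g w Eᶜ) :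
    ∫⁻ x, ‖w x‖ₑ ^ p * distWeight E (β - p) x ∂μ ≤
      C * (2 ^ (p - 1) * ∫⁻ x, g x ^ p * distWeight E β x ∂μ) := by
  set A : ℝ → ℝ≥0∞ := fun δ => ∫⁻ x in thickening δ E, ‖w x‖ₑ ^ p * distWeight E (β - p) x ∂μ
  have hA : Tendsto A (𝓝[>] 0) (𝓝 0) := tendsto_setLIntegral_thickening_zero hEc hfin
    fun x hx => by rw [distWeight_of_mem hx, mul_zero]
  have hlim : Tendsto (fun δ => A δ + C * (2 ^ (p - 1) *
      ((∫⁻ x, g x ^ p * distWeight E β x ∂μ) + 2 ^ p * A δ))) (𝓝[>] 0)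
      (𝓝 (0 + C * (2 ^ (p - 1) * ((∫⁻ x, g x ^ p * distWeight E β x ∂μ) + 2 ^ p * 0)))) := by
    refine hA.add (ENNReal.Tendsto.const_mul (ENNReal.Tendsto.const_mul (tendsto_const_nhds.add
      (ENNReal.Tendsto.const_mul hA ?_)) ?_) ?_) <;> exact Or.inr (by finiteness)
  rw [zero_add, mul_zero, add_zero] at hlim
  refine ge_of_tendsto hlim (eventually_mem_nhdsWithin.mono fun δ hδ => ?_)
  have hbound := hH.lintegral_le_add_setLIntegral_thickening (ε := (δ / 2).toNNReal) hEc hE hp hwm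
    hwc hM hsupp hg (Real.toNNReal_pos.2 (half_pos hδ))
  rwa [Real.coe_toNNReal _ (half_pos hδ).le, mul_div_cancel₀ δ two_ne_zero] at hbound

end HardyInequalityOff

theorem HardyInequalityOff.hardyInequalityFor_lipB {Ω : Set X} {p β : ℝ} {C K : ℝ≥0}
    (hH : HardyInequalityOff μ Ωᶜ p β C) (h : AikawaBound μ Ωᶜ (p - β) K)
    (hμ : IsPosFiniteOnBalls μ) (hΩ : IsOpen Ω) (hE : Ωᶜ.Nonempty) (hp : 1 ≤ p) :
    HardyInequalityFor μ Ω p β (LipB Ω) := by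
  refine ⟨C * 2 ^ (p - 1) + 1, by positivity, fun u hu g hg => ?_⟩
  have hEc : IsClosed Ωᶜ := hΩ.isClosed_compl
  have hmove : ∀ (f : X → ℝ≥0∞) (γ : ℝ),
      ∫⁻ x in Ω, f x * infEDist x Ωᶜ ^ γ ∂μ = ∫⁻ x, f x * distWeight Ωᶜ γ x ∂μ := fun f γ => by
    rw [← setLIntegral_compl_mul_infEDist_rpow hEc, compl_compl]
  obtain ⟨M, hM⟩ := exists_abs_indicator_le_of_mem_lipB hu
  obtain ⟨⟨L, hL⟩, hb⟩ := hu
  set w : X → ℝ := Ω.indicator u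
  have hwu : EqOn u w Ω := fun x hx => (indicator_of_mem hx u).symm
  have hwc : ContinuousOn w Ω := hL.continuousOn.congr hwu.symm
  have hwm : Measurable w := by
    classical
    rw [show w = Ω.piecewise u 0 from (piecewise_eq_indicator).symm]
    exact hL.continuousOn.measurable_piecewise continuousOn_const hΩ.measurableSet
  have hsupp : Bornology.IsBounded {x | w x ≠ 0} := hb.subset fun x hx =>
    indicator_apply_ne_zero.1 hx
  have hfin := h.lintegral_enorm_rpow_mul_distWeight_ne_top hμ hE (one_pos.trans_le hp) hM hsupp
  rw [neg_sub] at hfin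
  have hmain := hH.lintegral_le_of_continuousOn hEc hE hp hwm (by rwa [compl_compl]) hM hsupp hfin
    (by simpa only [compl_compl] using hg.congr hwu)
  have hleft : ∫⁻ x in Ω, ‖u x‖ₑ ^ p * infEDist x Ωᶜ ^ (β - p) ∂μ =
      ∫⁻ x, ‖w x‖ₑ ^ p * distWeight Ωᶜ (β - p) x ∂μ := by
    rw [← hmove]
    exact setLIntegral_congr_fun hΩ.measurableSet fun x hx => by rw [hwu hx]
  rw [hleft, hmove]
  refine hmain.trans ?_
  rw [← mul_assoc]
  gcongr
  rw [ENNReal.coe_add, ENNReal.coe_mul, ENNReal.coe_rpow_of_nonneg _ (by linarith)]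
  exact le_self_add

end RemovingTheBoundaryCondition

theorem HasCodimBound.exists_hardyInequalityOff {X : Type*} [MetricSpace X] [MeasurableSpace X]
    [BorelSpace X] {μ : Measure X} {E : Set X} {D C₀ : ℝ≥0} {t p β : ℝ}
    (hcodim : HasCodimBound μ E t C₀) (hμ : IsDoublingWith μ D)
    (hX : ¬ Bornology.IsBounded (univ : Set X)) (hEc : IsClosed E) (hE : E.Nonempty)
    (hp : 1 ≤ p) (hβ : β < p - 1) (ht : p - β < t)
    (hP_nonpos : β ≤ 0 → SupportsPoincare μ p) (hP_pos : 0 < β → SupportsPoincare μ (p - β)) :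
    ∃ C : ℝ≥0, HardyInequalityOff μ E p β C := by
  obtain ⟨s, hs, hst⟩ := exists_between ht
  obtain ⟨K, hK⟩ := hcodim.exists_aikawaBound hμ hEc hE (by linarith) hst
  rcases lt_trichotomy β 0 with hβ₀ | rfl | hβ₀
  · obtain ⟨δ, hδ, hδmin⟩ := exists_between (lt_min (by linarith : 0 < p) (sub_pos.2 hs))
    obtain ⟨hδp, hδs⟩ := lt_min_iff.1 hδmin
    obtain ⟨C, hC⟩ := hK.exists_hardyInequalityOff_of_neg (hP_nonpos hβ₀.le) hμ hX hEc hE hδ hδp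
    exact ⟨_, hC β hβ₀ (by linarith)⟩
  · exact hK.exists_hardyInequalityOff_zero (hP_nonpos le_rfl) hμ hX hEc hE (by linarith)
      (by linarith)
  · obtain ⟨C, hC⟩ := hK.exists_hardyInequalityOff_zero (hP_pos hβ₀) hμ hX hEc hE (by linarith) hs
    exact hC.exists_of_zero (hK.mono hEc hE (by linarith) hs.le) hμ.toIsPosFiniteOnBalls hEc hE hβ₀
      (by linarith)

theorem corollary6p5_general {X : Type*} [MetricSpace X] [MeasurableSpace X] [BorelSpace X]
    (μ : Measure X)
    (hball : ∀ (x : X) (r : ℝ), 0 < r → 0 < μ (closedBall x r) ∧ μ (closedBall x r) < ∞)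
    (hdoubling : IsDoublingMeasure μ)
    (hunbounded : ¬ Bornology.IsBounded (univ : Set X))
    (p β : ℝ) (hp : 1 ≤ p) (hβ : β < p - 1)
    (hpoincare_nonpos : β ≤ 0 → SupportsPoincare μ p)
    (hpoincare_pos : 0 < β → SupportsPoincare μ (p - β))
    (Ω : Set X) (hΩ : IsOpen Ω)
    (hcodim : ENNReal.ofReal (p - β) < lowerAssouadCodim μ Ωᶜ) :
    HardyInequalityFor μ Ω p β (LipB Ω) := by
  rcases Ωᶜ.eq_empty_or_nonempty with hE | hE
  · exact hardyInequalityFor_of_compl_eq_empty hE (by linarith) (LipB Ω)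
  have hEc : IsClosed Ωᶜ := hΩ.isClosed_compl
  obtain ⟨D, hD⟩ := hdoubling
  have hμ : IsDoublingWith μ D :=
    { pos := fun x r hr => (hball x r hr).1
      lt_top := fun x r hr => (hball x r hr).2
      two_mul_le := fun x r hr => hD x r hr }
  obtain ⟨t, C₀, ht, hcodim⟩ := exists_hasCodimBound hcodim
  obtain ⟨C, hC⟩ := hcodim.exists_hardyInequalityOff hμ hunbounded hEc hE hp hβ ht
    hpoincare_nonpos hpoincare_pos
  obtain ⟨K, hK⟩ := hcodim.exists_aikawaBound hμ hEc hE (by linarith) ht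
  exact hC.hardyInequalityFor_lipB hK hμ.toIsPosFiniteOnBalls hΩ hE hp

theorem corollary6p5 {X : Type*} [MetricSpace X] [CompleteSpace X]
    [MeasurableSpace X] [BorelSpace X] (μ : Measure X)
    (hball : ∀ (x : X) (r : ℝ), 0 < r → 0 < μ (closedBall x r) ∧ μ (closedBall x r) < ∞)
    (hdoubling : IsDoublingMeasure μ)
    (hunbounded : ¬ Bornology.IsBounded (univ : Set X))
    (p β : ℝ) (hp : 1 ≤ p) (hβ : β < p - 1)
    (hpoincare_nonpos : β ≤ 0 → SupportsPoincare μ p)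
    (hpoincare_pos : 0 < β → SupportsPoincare μ (p - β))
    (Ω : Set X) (hΩ : IsOpen Ω)
    (hcodim : ENNReal.ofReal (p - β) < lowerAssouadCodim μ Ωᶜ) :
    HardyInequalityFor μ Ω p β (LipB Ω) :=
  corollary6p5_general μ hball hdoubling hunbounded p β hp hβ hpoincare_nonpos hpoincare_pos Ω hΩ
    hcodim
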